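/- Let $N\ge 1$. Consider $N$ bosonic modes on $L^2(\mathbb R^N)$ with position operators $q_j$ (multiplication by $x_j$) and momentum operators $p_j=-i\,\partial_j$, and the Lindblad master equation $$\dot\rho=-i[H,\rho]+L\rho L^*-\tfrac12L^*L\rho-\tfrac12\rho L^*L .$$ Call the system *passive and locally coupled* if (i) $H=\sum_{1\le j\le k\le N} g_{jk}(q_jq_k+p_jp_k)$ with $g_{jk}\in\mathbb R$, and (ii) $L=c_1q_\ell+c_2p_\ell$ for some $c_1,c_2\in\mathbb C$ and some mode $\ell\in\{1,\dots,N\}$. A zero-mean pure Gaussian state is described by its graph matrix $Z=X+iY$, where $X,Y$ are real symmetric $N\times N$ matrices with $Y>0$; it is the pure Gaussian state whose covariance matrix (with respect to $(q_1,\dots,q_N,p_1,\dots,p_N)$) is $$V=\frac12\begin{bmatrix}Y^{-1}&Y^{-1}X\\ XY^{-1}&XY^{-1}X+Y\end{bmatrix}.$$ For $z\in\mathbb C$ with $\operatorname{Im}z>0$ let $\Delta(z)$ be the set of complex symmetric $2\times2$ matrices $B$ such that $\operatorname{Im}B>0$ (positive definite), $(\operatorname{diag}[1,-1]\,B)^2=-I_2$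 and $\det(B+\tfrac1zI_2)=0$. A zero-mean $N$-mode pure Gaussian state with graph matrix $Z$ is the unique steady state (among all density operators) of the master equation of some passive and locally coupled system if and only if $$Z=\mathcal P^\top\begin{bmatrix}\bar z&0\\0&\mathcal Q^\top\bar Z\mathcal Q\end{bmatrix}\mathcal P$$ for some $N\times N$ permutation matrix $\mathcal P$, some real orthogonal $(N-1)\times(N-1)$ matrix $\mathcal Q$, some $\bar z\in\mathbb C$ with $\operatorname{Im}\bar z>0$ ($\bar z$ is just the name of a complex number), and some $(N-1)\times(N-1)$ matrix $\bar Z$ of the following form: * if $N$ is odd, $\bar Z=\operatorname{diag}[\tilde Z_1,\dots,\tilde Z_{(N-1)/2}]$ with $\tilde Z_j\in\Delta(\bar z)$ for $1\le j\le (N-1)/2$; * if $N$ is even, $\bar Z=\operatorname{diag}[\tilde Z_1,\dots,\tilde Z_{N/2}]$ with the $1\times1$ block $\tilde Z_1=-1/\bar z$ and $\tilde Z_j\in\Delta(\bar z)$ for $2\le j\le N/2$. -/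

import Mathlib

open MeasureTheory Matrix
open scoped SchwartzMap LineDeriv ComplexConjugate

noncomputable section

namespace LinearQuantum

/-! ### Hilbert space, canonical operators, density operators -/

/-- Configuration space `ℝ^N` of `N` modes. -/
abbrev Conf (N : ℕ) : Type := EuclideanSpace ℝ (Fin N)

/-- The Hilbert space `L²(ℝ^N)` of an `N`-mode continuous-variable system. -/
abbrev Hilb (N : ℕ) : Type := Lp ℂ 2 (volume : Measure (Conf N))

/-- A Schwartz function, seen as a vector of `L²(ℝ^N)`. -/
def ket {N : ℕ} (φ : 𝓢(Conf N, ℂ)) : Hilb N := φ.toLp 2 volume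

/-- Position operator `q_j` of the `j`th mode, on the Schwartz space: `(q_j φ)(x) = x_j φ(x)`. -/
def position {N : ℕ} (j : Fin N) : 𝓢(Conf N, ℂ) →ₗ[ℂ] 𝓢(Conf N, ℂ) :=
  (SchwartzMap.smulLeftCLM ℂ (fun x : Conf N => ((x j : ℝ) : ℂ))).toLinearMap

/-- Momentum operator `p_j = -i ∂_j` of the `j`th mode (`ħ = 1`), on the Schwartz space. -/
def momentum {N : ℕ} (j : Fin N) : 𝓢(Conf N, ℂ) →ₗ[ℂ] 𝓢(Conf N, ℂ) :=
  (-Complex.I) •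
    (LineDeriv.lineDerivOpCLM ℂ 𝓢(Conf N, ℂ) (EuclideanSpace.single j (1 : ℝ))).toLinearMap

theorem position_apply {N : ℕ} (j : Fin N) (φ : 𝓢(Conf N, ℂ)) (x : Conf N) :
    position j φ x = (x j : ℂ) * φ x := by
  have h : (fun x : Conf N => ((x j : ℝ) : ℂ)).HasTemperateGrowth :=
    (Complex.ofRealCLM.comp (EuclideanSpace.proj (𝕜 := ℝ) j)).hasTemperateGrowth
  simp [position, SchwartzMap.smulLeftCLM_apply_apply h]

theorem momentum_apply {N : ℕ} (j : Fin N) (φ : 𝓢(Conf N, ℂ)) (x : Conf N) :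
    momentum j φ x = -Complex.I * lineDeriv ℝ φ x (EuclideanSpace.single j (1 : ℝ)) := by
  simp [momentum, SchwartzMap.lineDerivOp_apply]

/-- The vector of operators `(q_1, …, q_N, p_1, …, p_N)`. -/
def quadrature {N : ℕ} : Fin N ⊕ Fin N → (𝓢(Conf N, ℂ) →ₗ[ℂ] 𝓢(Conf N, ℂ)) :=
  Sum.elim position momentum

/-- Density operators: positive operators of trace one. -/
def IsDensityOperator {N : ℕ} (ρ : Hilb N →L[ℂ] Hilb N) : Prop :=
  ρ.IsPositive ∧
    ∀ (ι : Type) (b : HilbertBasis ι ℂ (Hilb N)), HasSum (fun i => inner ℂ (b i) (ρ (b i))) 1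

/-! ### Lindblad master equation -/

/-- The right-hand side
`-i[H, ρ] + L ρ L* - (1/2) L* L ρ - (1/2) ρ L* L`
of the Lindblad master equation, evaluated as a sesquilinear form between Schwartz functions
`φ` and `ψ` (`⟨φ, · ψ⟩`).  The Hamiltonian `H` is symmetric on the Schwartz space and `Lad` is the
(formal) adjoint of `L` there, so that every unbounded operator acts on a test function. -/
def lindbladForm {N : ℕ} (H L Lad : 𝓢(Conf N, ℂ) →ₗ[ℂ] 𝓢(Conf N, ℂ))
    (ρ : Hilb N →L[ℂ] Hilb N) (φ ψ : 𝓢(Conf N, ℂ)) : ℂ :=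
  -Complex.I * (inner ℂ (ket (H φ)) (ρ (ket ψ)) - inner ℂ (ket φ) (ρ (ket (H ψ))))
    + inner ℂ (ket (Lad φ)) (ρ (ket (Lad ψ)))
    - (1 / 2) * inner ℂ (ket (Lad (L φ))) (ρ (ket ψ))
    - (1 / 2) * inner ℂ (ket φ) (ρ (ket (Lad (L ψ))))

/-- `ρ(t)` solves the Lindblad master equation (weakly, tested on Schwartz functions). -/
def SolvesMasterEquation {N : ℕ} (H L Lad : 𝓢(Conf N, ℂ) →ₗ[ℂ] 𝓢(Conf N, ℂ))
    (ρ : ℝ → (Hilb N →L[ℂ] Hilb N)) : Prop :=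
  ∀ (φ ψ : 𝓢(Conf N, ℂ)) (t : ℝ),
    HasDerivAt (fun s => inner ℂ (ket φ) (ρ s (ket ψ))) (lindbladForm H L Lad (ρ t) φ ψ) t

/-- A linear quantum system with a passive Hamiltonian
`H = ∑_{j ≤ k} g_{jk} (q_j q_k + p_j p_k)` and a single Lindblad operator
`L = c₁ q_ℓ + c₂ p_ℓ` acting on a single mode `ℓ`. -/
structure PassiveLocalSystem (N : ℕ) where
  /-- Coefficients of the Hamiltonian (only the entries with `j ≤ k` are used). -/
  g : Fin N → Fin N → ℝ
  /-- The mode that is coupled to the reservoir. -/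
  site : Fin N
  /-- Coefficient of `q_ℓ` in the Lindblad operator. -/
  c₁ : ℂ
  /-- Coefficient of `p_ℓ` in the Lindblad operator. -/
  c₂ : ℂ

namespace PassiveLocalSystem

variable {N : ℕ} (S : PassiveLocalSystem N)

/-- `H = ∑_{j ≤ k} g_{jk} (q_j q_k + p_j p_k)`. -/
def hamiltonian : 𝓢(Conf N, ℂ) →ₗ[ℂ] 𝓢(Conf N, ℂ) :=
  ∑ j : Fin N, ∑ k ∈ Finset.Ici j,
    ((S.g j k : ℝ) : ℂ) • (position j ∘ₗ position k + momentum j ∘ₗ momentum k)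

/-- `L = c₁ q_ℓ + c₂ p_ℓ`. -/
def lindblad : 𝓢(Conf N, ℂ) →ₗ[ℂ] 𝓢(Conf N, ℂ) :=
  S.c₁ • position S.site + S.c₂ • momentum S.site

/-- `L* = c₁* q_ℓ + c₂* p_ℓ`. -/
def lindbladAdjoint : 𝓢(Conf N, ℂ) →ₗ[ℂ] 𝓢(Conf N, ℂ) :=
  conj S.c₁ • position S.site + conj S.c₂ • momentum S.site

/-- A steady state: a density operator that is a constant solution of the master equation. -/
def IsSteadyState (ρ : Hilb N →L[ℂ] Hilb N) : Prop :=
  IsDensityOperator ρ ∧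
    SolvesMasterEquation S.hamiltonian S.lindblad S.lindbladAdjoint (fun _ => ρ)

/-- `ρ` is the one and only steady state of the system. -/
def IsUniqueSteadyState (ρ : Hilb N →L[ℂ] Hilb N) : Prop :=
  S.IsSteadyState ρ ∧ ∀ ρ' : Hilb N →L[ℂ] Hilb N, S.IsSteadyState ρ' → ρ' = ρ

end PassiveLocalSystem

/-! ### Pure Gaussian states and their graph matrices -/

/-- A Gaussian graph matrix `Z = X + iY`: `X`, `Y` real symmetric and `Y > 0`. -/
def IsGraphMatrix {n : Type*} [Fintype n] (Z : Matrix n n ℂ) : Prop :=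
  Z.IsSymm ∧ (Z.map Complex.im).PosDef

/-- The covariance matrix
`V = (1/2) [Y⁻¹, Y⁻¹ X; X Y⁻¹, X Y⁻¹ X + Y]` encoded by the graph matrix `Z = X + iY`. -/
def covarianceOfGraph {N : ℕ} (Z : Matrix (Fin N) (Fin N) ℂ) :
    Matrix (Fin N ⊕ Fin N) (Fin N ⊕ Fin N) ℝ :=
  let X := Z.map Complex.re
  let Y := Z.map Complex.im
  (1 / 2 : ℝ) • fromBlocks Y⁻¹ (Y⁻¹ * X) (X * Y⁻¹) (X * Y⁻¹ * X + Y)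

/-- Mean value `⟨ψ, x_a ψ⟩` of a quadrature operator in the pure state `|ψ⟩⟨ψ|`. -/
def mean {N : ℕ} (ψ : 𝓢(Conf N, ℂ)) (a : Fin N ⊕ Fin N) : ℂ :=
  inner ℂ (ket ψ) (ket (quadrature a ψ))

/-- The deviation operator `Δx_a = x_a - ⟨x_a⟩`. -/
def deviation {N : ℕ} (ψ : 𝓢(Conf N, ℂ)) (a : Fin N ⊕ Fin N) :
    𝓢(Conf N, ℂ) →ₗ[ℂ] 𝓢(Conf N, ℂ) :=
  quadrature a - mean ψ a • LinearMap.id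

/-- The covariance matrix `(1/2) ⟨Δx_a Δx_b + Δx_b Δx_a⟩` of the pure state `|ψ⟩⟨ψ|`. -/
def covariance {N : ℕ} (ψ : 𝓢(Conf N, ℂ)) : Matrix (Fin N ⊕ Fin N) (Fin N ⊕ Fin N) ℂ :=
  Matrix.of fun a b => (1 / 2) *
    inner ℂ (ket ψ)
      (ket (deviation ψ a (deviation ψ b ψ) + deviation ψ b (deviation ψ a ψ)))

/-- Gaussian wave functions: exponentials of a quadratic polynomial on `ℝ^N`. -/
def IsGaussianWave {N : ℕ} (ψ : 𝓢(Conf N, ℂ)) : Prop :=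
  ∃ (M : Matrix (Fin N) (Fin N) ℂ) (b : Fin N → ℂ) (c : ℂ), M.IsSymm ∧
    ∀ x : Conf N, ψ x = Complex.exp
      (-(1 / 2) * ∑ j, ∑ k, (x j : ℂ) * M j k * (x k : ℂ) + ∑ j, b j * (x j : ℂ) + c)

/-- `ρ` is a zero-mean pure Gaussian state whose graph matrix is `Z`: it is `|ψ⟩⟨ψ|` for a
normalized Gaussian wave function `ψ`, and its covariance matrix is the one encoded by `Z`. -/
def IsPureGaussianState {N : ℕ} (Z : Matrix (Fin N) (Fin N) ℂ)
    (ρ : Hilb N →L[ℂ] Hilb N) : Prop :=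
  IsGraphMatrix Z ∧ ∃ ψ : 𝓢(Conf N, ℂ),
    IsGaussianWave ψ ∧ ‖ket ψ‖ = 1 ∧ ρ = InnerProductSpace.rankOne ℂ (ket ψ) (ket ψ) ∧
    (∀ a, mean ψ a = 0) ∧
    covariance ψ = (covarianceOfGraph Z).map (fun r : ℝ => (r : ℂ))

/-! ### Block matrices of the parametrization -/

/-- The set `Δ` of `2 × 2` matrices attached to `z`. -/
def Delta (z : ℂ) : Set (Matrix (Fin 2) (Fin 2) ℂ) :=
  {B | IsGraphMatrix B ∧ (diagonal ![1, -1] * B) ^ 2 = -1 ∧ (B + (1 / z) • 1).det = 0}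

/-- `diag[B_1, …, B_m]` with `2 × 2` blocks, of size `2m`. -/
def diagBlocks {m : ℕ} (B : Fin m → Matrix (Fin 2) (Fin 2) ℂ) :
    Matrix (Fin (m * 2)) (Fin (m * 2)) ℂ :=
  reindex ((Equiv.prodComm _ _).trans finProdFinEquiv)
    ((Equiv.prodComm _ _).trans finProdFinEquiv) (blockDiagonal B)

/-- `diag[z, A]` with a `1 × 1` block `z` and an `n × n` block `A`, of size `1 + n`. -/
def diagCons {n : ℕ} (z : ℂ) (A : Matrix (Fin n) (Fin n) ℂ) :
    Matrix (Fin (1 + n)) (Fin (1 + n)) ℂ :=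
  reindex finSumFinEquiv finSumFinEquiv (fromBlocks (Matrix.of fun _ _ : Fin 1 => z) 0 0 A)

/-- `Z = 𝒫ᵀ diag[z, 𝒬ᵀ A 𝒬] 𝒫` for some permutation matrix `𝒫` and some real orthogonal
matrix `𝒬`. -/
def HasForm {n : ℕ} (Z : Matrix (Fin (1 + n)) (Fin (1 + n)) ℂ) (z : ℂ)
    (A : Matrix (Fin n) (Fin n) ℂ) : Prop :=
  ∃ (σ : Equiv.Perm (Fin (1 + n))) (Q : Matrix (Fin n) (Fin n) ℝ),
    Q ∈ orthogonalGroup (Fin n) ℝ ∧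
    Z = (σ.permMatrix ℂ)ᵀ *
      diagCons z ((Q.map (fun r : ℝ => (r : ℂ)))ᵀ * A * Q.map (fun r : ℝ => (r : ℂ))) *
      σ.permMatrix ℂ

end LinearQuantum

end

/-!
A pure Gaussian state with graph matrix `Z` has a wave function `ψ` proportional to
`exp (i xᵀ Z x / 2)`: expanding `‖(p_j - ∑ Z_jk q_k) ψ‖²` with the covariance matrix and the
commutation relations gives `0`, so `ψ` is annihilated by the *nullifiers* `p(u) - q(Z u)`
(`nullifier_of_covariance`). Write `R` for the real symmetric matrix with
`H = ½ ∑ R_jk (q_j q_k + p_j p_k)`.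

*Stationarity.* If `|ψ⟩⟨ψ|` is stationary, testing the master equation on `L ψ` forces `L ψ = 0`,
and then `ψ` is an eigenvector of `H`. In terms of `Z` this says `c₁ e_l + c₂ Z e_l = 0` and
`R + Z R Z = 0` (`PassiveLocalSystem.algebraic_of_stationary`). The second equation exchanges
eigenvectors of `Z` with eigenvalues `w` and `-1/w`: if `Z e_l = z e_l` then
`Z R^k e_l = z_k R^k e_l`, where `z_k` alternates between `z` and `-1/z`.

*Uniqueness* holds exactly when `c₂ ≠ 0` and the vectors `R^k e_l` span everything. If they do not,
or if `c₂ = 0`, there is an eigenvector `u` of `Z R` for which `q(u) ψ` is annihilated by `L` and is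
an eigenvector of `H`, so that it spans a second stationary state
(`PassiveLocalSystem.not_isUniqueSteadyState`). Conversely, filter the span of the polynomial
multiples of `ψ` by the degree `n`. The Hamiltonian preserves this Fock filtration, `L` lowers it
and `L*` raises it. For a steady state `ρ`, the traces of `L ρ L*` over the successive levels are
therefore all equal, hence equal to that over the bottom level, which vanishes; so `ρ` kills the
image of `L*`. Commuting `L*` repeatedly with `H`, the operator `ρ` kills the images of all the
creation operators, by the spanning hypothesis, and `ρ = |ψ⟩⟨ψ|` because the polynomial multiples
of `ψ` are dense (`PassiveLocalSystem.isUniqueSteadyState_of_cyclic`). Density is proved with the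
Fourier transform.

*Normal form.* Applying Gram–Schmidt to the real vectors `R^k e_l` produces an orthogonal matrix
`W` with a coordinate vector as first row and `Z = Wᵀ diag(z, -1/z, z, …) W`
(`hasAlternatingEigenbasis_of_cyclic`). Given such a `W`, the choice `R = Wᵀ J W` with `J` the
adjacency matrix of a path, together with `L = p_l - z q_l`, is a system with the required steady
state, whence `exists_unique_iff_hasAlternatingEigenbasis`. Finally `Δ(z)` consists of the matrices
`Oᵀ diag(z, -1/z) O` with `O` orthogonal of size two, so the block parametrization is a
rewriting of the alternating eigenbasis (`hasAlternatingEigenbasis_iff_odd`,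
`hasAlternatingEigenbasis_iff_even`).
-/

noncomputable section

namespace LinearQuantum

variable {N : ℕ}

/-! ### Canonical commutation relations and symmetry of the quadratures -/

theorem momentum_apply_fderiv (j : Fin N) (φ : 𝓢(Conf N, ℂ)) (x : Conf N) :
    momentum j φ x = -Complex.I * fderiv ℝ φ x (EuclideanSpace.single j 1) := by
  rw [momentum_apply, φ.differentiableAt.lineDeriv_eq_fderiv]

theorem position_comm (j k : Fin N) :
    (position j : Module.End ℂ 𝓢(Conf N, ℂ)) * position k = position k * position j := by
  ext φ x
  simp only [Module.End.mul_apply, position_apply]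
  ring

theorem momentum_comm (j k : Fin N) :
    (momentum j : Module.End ℂ 𝓢(Conf N, ℂ)) * momentum k = momentum k * momentum j := by
  have key : ∀ (v w : Conf N) (φ : 𝓢(Conf N, ℂ)) (x : Conf N),
      (∂_{v} (∂_{w} φ)) x = fderiv ℝ (fderiv ℝ φ) x v w := by
    intro v w φ x
    rw [SchwartzMap.lineDerivOp_apply_eq_fderiv]
    have h : ((∂_{w} φ : 𝓢(Conf N, ℂ)) : Conf N → ℂ) = fun y => fderiv ℝ φ y w := by
      ext y
      rw [SchwartzMap.lineDerivOp_apply_eq_fderiv]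
    rw [h, fderiv_clm_apply _ (differentiableAt_const _)]
    · simp
    · exact ((φ.smooth 2).fderiv_right (m := 1) (by norm_num)).differentiable (by simp) x
  ext φ x
  have hs : IsSymmSndFDerivAt ℝ φ x :=
    (φ.smooth 2).contDiffAt.isSymmSndFDerivAt (by simp)
  simp only [momentum, Module.End.mul_apply, LinearMap.smul_apply,
    ContinuousLinearMap.coe_coe, LineDeriv.lineDerivOpCLM_apply, map_smul, _root_.smul_apply,
    key, hs.eq (EuclideanSpace.single j (1 : ℝ)) (EuclideanSpace.single k (1 : ℝ))]

theorem momentum_mul_position (j k : Fin N) :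
    (momentum j : Module.End ℂ 𝓢(Conf N, ℂ)) * position k =
      position k * momentum j - (if j = k then Complex.I else 0) • 1 := by
  ext φ x
  have h : ((position k φ : 𝓢(Conf N, ℂ)) : Conf N → ℂ) =
      fun y => ((Complex.ofRealCLM.comp (EuclideanSpace.proj (𝕜 := ℝ) k)) y) * φ y := by
    ext y
    simp [position_apply]
  simp only [Module.End.mul_apply, LinearMap.sub_apply, _root_.sub_apply,
    momentum_apply_fderiv, position_apply, LinearMap.smul_apply, Module.End.one_apply,
    _root_.smul_apply]
  rw [h, fderiv_fun_mul (ContinuousLinearMap.differentiableAt _) φ.differentiableAt]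
  rw [ContinuousLinearMap.fderiv]
  simp only [_root_.add_apply, _root_.smul_apply,
    ContinuousLinearMap.comp_apply, Complex.ofRealCLM_apply,
    smul_eq_mul]
  have hproj : ∀ y : Conf N, (EuclideanSpace.proj (𝕜 := ℝ) k) y = y k := fun y => rfl
  rw [hproj, hproj, PiLp.single_apply]
  by_cases hjk : j = k
  · subst hjk
    simp only [if_true, Complex.ofReal_one]
    ring
  · simp only [hjk, if_false, Ne.symm hjk, Complex.ofReal_zero]
    ring

/-- The inclusion of the Schwartz space into `L²(ℝ^N)` as a linear map. -/
def ketₗ : 𝓢(Conf N, ℂ) →ₗ[ℂ] Hilb N := (SchwartzMap.toLpCLM ℂ ℂ 2 volume).toLinearMap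

theorem ket_add (φ χ : 𝓢(Conf N, ℂ)) : ket (φ + χ) = ket φ + ket χ := map_add ketₗ φ χ
theorem ket_sub (φ χ : 𝓢(Conf N, ℂ)) : ket (φ - χ) = ket φ - ket χ := map_sub ketₗ φ χ
theorem ket_smul (c : ℂ) (φ : 𝓢(Conf N, ℂ)) : ket (c • φ) = c • ket φ := map_smul ketₗ c φ
theorem ket_zero : ket (0 : 𝓢(Conf N, ℂ)) = 0 := map_zero ketₗ
theorem ket_sum {ι : Type*} (s : Finset ι) (f : ι → 𝓢(Conf N, ℂ)) :
    ket (∑ i ∈ s, f i) = ∑ i ∈ s, ket (f i) := map_sum ketₗ f s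

theorem ket_injective : Function.Injective (ket : 𝓢(Conf N, ℂ) → Hilb N) :=
  SchwartzMap.injective_toLp 2 volume

theorem ket_eq_zero {φ : 𝓢(Conf N, ℂ)} (h : ket φ = 0) : φ = 0 :=
  ket_injective (h.trans ket_zero.symm)

theorem inner_ket (φ χ : 𝓢(Conf N, ℂ)) :
    inner ℂ (ket φ) (ket χ) = ∫ x, conj (φ x) * χ x := by
  refine (SchwartzMap.inner_toL2_toL2_eq φ χ volume).trans ?_
  refine integral_congr_ae (Filter.Eventually.of_forall fun x => ?_)
  simp [mul_comm]

theorem inner_position (j : Fin N) (φ χ : 𝓢(Conf N, ℂ)) :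
    inner ℂ (ket (position j φ)) (ket χ) = inner ℂ (ket φ) (ket (position j χ)) := by
  rw [inner_ket, inner_ket]
  refine integral_congr_ae (Filter.Eventually.of_forall fun x => ?_)
  simp only [position_apply, map_mul, Complex.conj_ofReal]
  ring

theorem inner_momentum (j : Fin N) (φ χ : 𝓢(Conf N, ℂ)) :
    inner ℂ (ket (momentum j φ)) (ket χ) = inner ℂ (ket φ) (ket (momentum j χ)) := by
  rw [inner_ket, inner_ket]
  have h := SchwartzMap.integral_bilinear_lineDerivOp_right_eq_neg_left (μ := volume) φ χ
    ((ContinuousLinearMap.mul ℝ ℂ).comp Complex.conjCLE.toContinuousLinearMap)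
    (EuclideanSpace.single j (1 : ℝ))
  simp only [ContinuousLinearMap.comp_apply, ContinuousLinearMap.mul_apply',
    SchwartzMap.lineDerivOp_apply] at h
  simp only [momentum_apply, map_mul, map_neg, Complex.conj_I]
  calc _ = Complex.I * ∫ x, conj (lineDeriv ℝ φ x (EuclideanSpace.single j 1)) * χ x := by
        rw [← integral_const_mul]
        refine integral_congr_ae (Filter.Eventually.of_forall fun x => ?_)
        simp [mul_assoc]
    _ = -Complex.I * ∫ x, conj (φ x) * lineDeriv ℝ χ x (EuclideanSpace.single j 1) := by
        have h' : (∫ x, conj (φ x) * lineDeriv ℝ χ x (EuclideanSpace.single j 1)) =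
          - ∫ x, conj (lineDeriv ℝ φ x (EuclideanSpace.single j 1)) * χ x := h
        rw [h']; ring
    _ = _ := by
        rw [← integral_const_mul]
        refine integral_congr_ae (Filter.Eventually.of_forall fun x => ?_)
        simp only
        ring

/-! ### Linear and quadratic expressions in the quadratures -/

/-- The operator `q(u) = ∑ u_k q_k`. -/
def posLin (u : Fin N → ℂ) : Module.End ℂ 𝓢(Conf N, ℂ) := ∑ k, u k • position k

/-- The operator `p(u) = ∑ u_k p_k`. -/
def momLin (u : Fin N → ℂ) : Module.End ℂ 𝓢(Conf N, ℂ) := ∑ k, u k • momentum k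

/-- The quadratic Hamiltonian `(1/2) ∑ R_{jk} (q_j q_k + p_j p_k)`, both orders of each pair
being summed. -/
def quadHam (R : Matrix (Fin N) (Fin N) ℂ) : Module.End ℂ 𝓢(Conf N, ℂ) :=
  (1 / 2 : ℂ) • ∑ j, (position j * posLin (R j) + momentum j * momLin (R j))

theorem posLin_apply (u : Fin N → ℂ) (φ : 𝓢(Conf N, ℂ)) (x : Conf N) :
    posLin u φ x = (∑ k, u k * (x k : ℂ)) * φ x := by
  simp [posLin, LinearMap.sum_apply, position_apply, Finset.sum_mul,
    mul_assoc]

theorem posLin_add (u v : Fin N → ℂ) : posLin (u + v) = posLin u + posLin v := by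
  simp [posLin, add_smul, Finset.sum_add_distrib]

theorem posLin_smul (c : ℂ) (u : Fin N → ℂ) : posLin (c • u) = c • posLin u := by
  simp [posLin, mul_smul, Finset.smul_sum]

theorem momLin_add (u v : Fin N → ℂ) : momLin (u + v) = momLin u + momLin v := by
  simp [momLin, add_smul, Finset.sum_add_distrib]

theorem momLin_smul (c : ℂ) (u : Fin N → ℂ) : momLin (c • u) = c • momLin u := by
  simp [momLin, mul_smul, Finset.smul_sum]

theorem posLin_zero : posLin (0 : Fin N → ℂ) = 0 := by simp [posLin]
theorem momLin_zero : momLin (0 : Fin N → ℂ) = 0 := by simp [momLin]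

theorem posLin_neg (u : Fin N → ℂ) : posLin (-u) = -posLin u := by
  simp [posLin]

theorem posLin_sub (u v : Fin N → ℂ) : posLin (u - v) = posLin u - posLin v := by
  rw [sub_eq_add_neg, posLin_add, posLin_neg, sub_eq_add_neg]

theorem posLin_single (k : Fin N) : posLin (Pi.single k 1) = position k := by
  simp [posLin, Pi.single_apply]

theorem momLin_single (k : Fin N) : momLin (Pi.single k 1) = momentum k := by
  simp [momLin, Pi.single_apply]

/-- Linear combinations of position operators, with the coefficients given by the columns of a
matrix. -/
theorem sum_smul_posLin (A : Matrix (Fin N) (Fin N) ℂ) (u : Fin N → ℂ) :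
    ∑ j, u j • posLin (A j) = posLin (Aᵀ *ᵥ u) := by
  simp only [posLin, Finset.smul_sum, smul_smul, mulVec, dotProduct, transpose_apply,
    Finset.sum_smul]
  rw [Finset.sum_comm]
  simp only [mul_comm]

theorem sum_smul_momLin (A : Matrix (Fin N) (Fin N) ℂ) (u : Fin N → ℂ) :
    ∑ j, u j • momLin (A j) = momLin (Aᵀ *ᵥ u) := by
  simp only [momLin, Finset.smul_sum, smul_smul, mulVec, dotProduct, transpose_apply,
    Finset.sum_smul]
  rw [Finset.sum_comm]
  simp only [mul_comm]

theorem position_mul_posLin (j : Fin N) (u : Fin N → ℂ) :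
    position j * posLin u = posLin u * position j := by
  simp only [posLin, Finset.mul_sum, Finset.sum_mul, mul_smul_comm, smul_mul_assoc,
    position_comm j]

theorem posLin_comm (u v : Fin N → ℂ) : posLin u * posLin v = posLin v * posLin u := by
  conv_lhs => rw [posLin]
  conv_rhs => rw [posLin.eq_1 u]
  simp only [Finset.mul_sum, Finset.sum_mul, mul_smul_comm, smul_mul_assoc, position_mul_posLin]

theorem momentum_mul_momLin (j : Fin N) (u : Fin N → ℂ) :
    momentum j * momLin u = momLin u * momentum j := by
  simp only [momLin, Finset.mul_sum, Finset.sum_mul, mul_smul_comm, smul_mul_assoc,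
    momentum_comm j]

theorem momLin_comm (u v : Fin N → ℂ) : momLin u * momLin v = momLin v * momLin u := by
  conv_lhs => rw [momLin]
  conv_rhs => rw [momLin.eq_1 u]
  simp only [Finset.mul_sum, Finset.sum_mul, mul_smul_comm, smul_mul_assoc, momentum_mul_momLin]

theorem momentum_mul_posLin (j : Fin N) (v : Fin N → ℂ) :
    momentum j * posLin v = posLin v * momentum j - (Complex.I * v j) • 1 := by
  simp only [posLin, Finset.mul_sum, Finset.sum_mul, mul_smul_comm, smul_mul_assoc,
    momentum_mul_position, smul_sub, Finset.sum_sub_distrib, ite_smul, zero_smul, smul_ite,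
    smul_zero, Finset.sum_ite_eq, Finset.mem_univ, if_true, smul_smul]
  rw [mul_comm]

theorem momLin_mul_posLin (u v : Fin N → ℂ) :
    momLin u * posLin v = posLin v * momLin u - (Complex.I * (u ⬝ᵥ v)) • 1 := by
  simp only [momLin, Finset.mul_sum, Finset.sum_mul, mul_smul_comm, smul_mul_assoc,
    momentum_mul_posLin, smul_sub, Finset.sum_sub_distrib, smul_smul, dotProduct, Finset.sum_smul]
  simp only [mul_left_comm]

theorem momLin_mul_position (u : Fin N → ℂ) (j : Fin N) :
    momLin u * position j = position j * momLin u - (Complex.I * u j) • 1 := by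
  have := momLin_mul_posLin u (Pi.single j 1)
  rwa [posLin_single, dotProduct_single, mul_one] at this

/-- The commutator `[H, q(u)] = -i p(R u)`. -/
theorem quadHam_mul_posLin {R : Matrix (Fin N) (Fin N) ℂ} (hR : R.IsSymm) (u : Fin N → ℂ) :
    quadHam R * posLin u = posLin u * quadHam R - Complex.I • momLin (R *ᵥ u) := by
  have h : ∀ j, (position j * posLin (R j) + momentum j * momLin (R j)) * posLin u =
      posLin u * (position j * posLin (R j) + momentum j * momLin (R j))
        - Complex.I • (u j • momLin (R j)) - Complex.I • ((R *ᵥ u) j • momentum j) := by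
    intro j
    have e1 : position j * posLin (R j) * posLin u = posLin u * (position j * posLin (R j)) := by
      rw [mul_assoc, posLin_comm, ← mul_assoc, position_mul_posLin, mul_assoc]
    have e2 : momentum j * momLin (R j) * posLin u = posLin u * (momentum j * momLin (R j))
        - Complex.I • (u j • momLin (R j)) - Complex.I • ((R *ᵥ u) j • momentum j) := by
      rw [mul_assoc, momLin_mul_posLin, mul_sub, ← mul_assoc, momentum_mul_posLin, sub_mul,
        mul_assoc, smul_mul_assoc, one_mul, mul_smul_comm, mul_one, smul_smul, smul_smul]
      rfl
    rw [add_mul, e1, e2, mul_add]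
    abel
  rw [quadHam, smul_mul_assoc, Finset.sum_mul, mul_smul_comm, Finset.mul_sum]
  simp only [h, Finset.sum_sub_distrib, ← Finset.smul_sum, sum_smul_momLin, hR.eq]
  have e3 : ∑ j, (R *ᵥ u) j • momentum j = momLin (R *ᵥ u) := rfl
  rw [e3]
  module

/-- The commutator `[H, p(u)] = i q(R u)`. -/
theorem quadHam_mul_momLin {R : Matrix (Fin N) (Fin N) ℂ} (hR : R.IsSymm) (u : Fin N → ℂ) :
    quadHam R * momLin u = momLin u * quadHam R + Complex.I • posLin (R *ᵥ u) := by
  have h : ∀ j, momLin u * (position j * posLin (R j) + momentum j * momLin (R j)) =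
      (position j * posLin (R j) + momentum j * momLin (R j)) * momLin u
        - Complex.I • (u j • posLin (R j)) - Complex.I • ((R *ᵥ u) j • position j) := by
    intro j
    have e1 : momLin u * (momentum j * momLin (R j)) = momentum j * momLin (R j) * momLin u := by
      rw [mul_assoc, momLin_comm (R j), ← mul_assoc, ← momentum_mul_momLin, mul_assoc]
    have e2 : momLin u * (position j * posLin (R j)) = position j * posLin (R j) * momLin u
        - Complex.I • (u j • posLin (R j)) - Complex.I • ((R *ᵥ u) j • position j) := by
      rw [← mul_assoc, momLin_mul_position, sub_mul, mul_assoc, momLin_mul_posLin, mul_sub,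
        mul_assoc, smul_mul_assoc, one_mul, mul_smul_comm, mul_one, smul_smul, smul_smul,
        dotProduct_comm]
      rw [sub_right_comm]
      rfl
    rw [mul_add, e1, e2, add_mul]
    abel
  rw [quadHam, smul_mul_assoc, Finset.sum_mul, mul_smul_comm, Finset.mul_sum]
  simp only [h, Finset.sum_sub_distrib, ← Finset.smul_sum, sum_smul_posLin, hR.eq]
  have e3 : ∑ j, (R *ᵥ u) j • position j = posLin (R *ᵥ u) := rfl
  rw [e3]
  module

theorem inner_posLin (u : Fin N → ℂ) (φ χ : 𝓢(Conf N, ℂ)) :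
    inner ℂ (ket (posLin u φ)) (ket χ) = inner ℂ (ket φ) (ket (posLin (star u) χ)) := by
  simp [posLin, LinearMap.sum_apply, ket_sum, sum_inner, inner_sum, ket_smul, inner_smul_left,
    inner_smul_right, inner_position]

theorem inner_momLin (u : Fin N → ℂ) (φ χ : 𝓢(Conf N, ℂ)) :
    inner ℂ (ket (momLin u φ)) (ket χ) = inner ℂ (ket φ) (ket (momLin (star u) χ)) := by
  simp [momLin, LinearMap.sum_apply, ket_sum, sum_inner, inner_sum, ket_smul, inner_smul_left,
    inner_smul_right, inner_momentum]

theorem inner_quadHam {R : Matrix (Fin N) (Fin N) ℂ} (hR : ∀ j, star (R j) = R j)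
    (φ χ : 𝓢(Conf N, ℂ)) :
    inner ℂ (ket (quadHam R φ)) (ket χ) = inner ℂ (ket φ) (ket (quadHam R χ)) := by
  have h : ∀ j, inner ℂ (ket ((position j * posLin (R j) + momentum j * momLin (R j)) φ)) (ket χ) =
      inner ℂ (ket φ) (ket ((position j * posLin (R j) + momentum j * momLin (R j)) χ)) := by
    intro j
    rw [LinearMap.add_apply, LinearMap.add_apply, ket_add, ket_add, inner_add_left,
      inner_add_right]
    congr 1
    · conv_rhs => rw [position_mul_posLin]
      simp only [Module.End.mul_apply, inner_position, inner_posLin, hR]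
    · conv_rhs => rw [momentum_mul_momLin]
      simp only [Module.End.mul_apply, inner_momentum, inner_momLin, hR]
  have h2 : conj (1 / 2 : ℂ) = 1 / 2 := by
    rw [show (1 / 2 : ℂ) = ((1 / 2 : ℝ) : ℂ) by norm_num, Complex.conj_ofReal]
  simp only [quadHam, LinearMap.smul_apply, LinearMap.sum_apply, ket_smul, ket_sum, sum_inner,
    inner_sum, inner_smul_left, inner_smul_right, h, h2]

namespace PassiveLocalSystem

variable (S : PassiveLocalSystem N)

/-- The real symmetric matrix `R` with `H = (1/2) ∑ R_{jk} (q_j q_k + p_j p_k)`. -/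
def couplingMatrix : Matrix (Fin N) (Fin N) ℝ :=
  Matrix.of fun j k => if j = k then 2 * S.g j j else if j < k then S.g j k else S.g k j

theorem couplingMatrix_isSymm : S.couplingMatrix.IsSymm := by
  ext j k
  simp only [couplingMatrix, transpose_apply, of_apply]
  rcases lt_trichotomy j k with h | h | h
  · simp [h.ne, h.ne', h, h.not_gt]
  · simp [h]
  · simp [h.ne, h.ne', h, h.not_gt]

theorem hamiltonian_eq : S.hamiltonian = quadHam (S.couplingMatrix.map Complex.ofReal) := by
  set T : Fin N → Fin N → Module.End ℂ 𝓢(Conf N, ℂ) :=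
    fun j k => position j * position k + momentum j * momentum k with hT
  have hTs : ∀ j k, T j k = T k j := fun j k => by
    simp only [hT, position_comm j k, momentum_comm j k]
  have e1 : S.hamiltonian = ∑ j : Fin N, ∑ k : Fin N,
      if j ≤ k then ((S.g j k : ℝ) : ℂ) • T j k else 0 := by
    unfold hamiltonian
    refine Finset.sum_congr rfl fun j _ => ?_
    rw [← Finset.sum_filter]
    refine Finset.sum_congr ?_ fun k _ => rfl
    ext k; simp
  have e2 : S.hamiltonian = ∑ j : Fin N, ∑ k : Fin N,
      if k ≤ j then ((S.g k j : ℝ) : ℂ) • T j k else 0 := by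
    rw [e1, Finset.sum_comm]
    simp only [hTs]
  have e3 : S.hamiltonian = (1 / 2 : ℂ) • (S.hamiltonian + S.hamiltonian) := by module
  rw [e3]
  nth_rewrite 1 [e1]
  rw [e2, ← Finset.sum_add_distrib, quadHam]
  congr 1
  refine Finset.sum_congr rfl fun j _ => ?_
  simp only [posLin, momLin, Finset.mul_sum, ← Finset.sum_add_distrib, mul_smul_comm, ← smul_add]
  refine Finset.sum_congr rfl fun k _ => ?_
  simp only [couplingMatrix, map_apply, of_apply]
  rcases lt_trichotomy j k with h | h | h
  · simp [h.le, h.ne, h, h.not_ge, hT]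
  · simp [h, hT, two_mul, add_smul]
    abel
  · simp [h.le, h.ne', h.not_gt, h.not_ge, hT]

theorem lindblad_apply (φ : 𝓢(Conf N, ℂ)) :
    S.lindblad φ = S.c₁ • position S.site φ + S.c₂ • momentum S.site φ := rfl

theorem inner_hamiltonian (φ χ : 𝓢(Conf N, ℂ)) :
    inner ℂ (ket (S.hamiltonian φ)) (ket χ) = inner ℂ (ket φ) (ket (S.hamiltonian χ)) := by
  rw [hamiltonian_eq]
  exact inner_quadHam (fun j => by ext k; simp) φ χ

theorem inner_lindblad (φ χ : 𝓢(Conf N, ℂ)) :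
    inner ℂ (ket (S.lindblad φ)) (ket χ) = inner ℂ (ket φ) (ket (S.lindbladAdjoint χ)) := by
  simp [lindblad, lindbladAdjoint, ket_add, ket_smul, inner_add_left, inner_add_right,
    inner_smul_left, inner_smul_right, inner_position, inner_momentum]

theorem inner_lindbladAdjoint (φ χ : 𝓢(Conf N, ℂ)) :
    inner ℂ (ket (S.lindbladAdjoint φ)) (ket χ) = inner ℂ (ket φ) (ket (S.lindblad χ)) := by
  rw [← inner_conj_symm, ← inner_lindblad, inner_conj_symm]

end PassiveLocalSystem

/-! ### Nullifiers of a pure Gaussian state -/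

theorem matrix_re_add_im {n : Type*} (Z : Matrix n n ℂ) :
    (Z.map Complex.re).map Complex.ofReal + Complex.I • (Z.map Complex.im).map Complex.ofReal
      = Z := by
  ext j k
  simp [mul_comm Complex.I, Complex.re_add_im]

theorem matrix_re_sub_im {n : Type*} (Z : Matrix n n ℂ) :
    (Z.map Complex.re).map Complex.ofReal - Complex.I • (Z.map Complex.im).map Complex.ofReal
      = Z.map conj := by
  ext j k
  apply Complex.ext <;> simp

/-- The identity between the blocks of the covariance matrix and the graph matrix that makes the
nullifiers `p_j - ∑ Z_{jk} q_k` vanish on the state. -/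
theorem covariance_nullifier_identity {n : Type*} [Fintype n] [DecidableEq n]
    {X Y A : Matrix n n ℂ} (hAY : A * Y = 1) (hYA : Y * A = 1) :
    (X * A * X + Y) - (X * A * (X + Complex.I • Y) - Complex.I • (X + Complex.I • Y))
      - ((X - Complex.I • Y) * (A * X) + Complex.I • (X - Complex.I • Y))
      + (X - Complex.I • Y) * A * (X + Complex.I • Y) = 0 := by
  have h1 : X * A * Y = X := by rw [mul_assoc, hAY, mul_one]
  have h2 : Y * A * X = X := by rw [hYA, one_mul]
  have h3 : Y * A * Y = Y := by rw [hYA, one_mul]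
  simp only [mul_add, sub_mul, mul_smul_comm, smul_mul_assoc, ← mul_assoc, h1, h2, h3,
    smul_sub, smul_add, smul_smul, Complex.I_mul_I]
  module

theorem posLin_sum_inner_left (u : Fin N → ℂ) (φ χ : 𝓢(Conf N, ℂ)) :
    inner ℂ (ket (posLin u φ)) (ket χ) =
      ∑ k, conj (u k) * inner ℂ (ket φ) (ket (position k χ)) := by
  simp [posLin, LinearMap.sum_apply, ket_sum, sum_inner, ket_smul, inner_smul_left,
    inner_position]

theorem inner_posLin_right (u : Fin N → ℂ) (φ χ : 𝓢(Conf N, ℂ)) :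
    inner ℂ (ket φ) (ket (posLin u χ)) =
      ∑ k, u k * inner ℂ (ket φ) (ket (position k χ)) := by
  simp [posLin, LinearMap.sum_apply, ket_sum, inner_sum, ket_smul, inner_smul_right]

/-- A zero-mean state whose covariance matrix is the one encoded by `Z` is annihilated by the
operators `p_j - ∑ Z_{jk} q_k`: the covariance matrix and the canonical commutation relations
determine the norm of the image, which is zero. -/
theorem nullifier_of_covariance {Z : Matrix (Fin N) (Fin N) ℂ} (hZ : IsGraphMatrix Z)
    {ψ : 𝓢(Conf N, ℂ)} (hψ : ‖ket ψ‖ = 1) (hmean : ∀ a, mean ψ a = 0)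
    (hcov : covariance ψ = (covarianceOfGraph Z).map (fun r : ℝ => (r : ℂ))) (j : Fin N) :
    momentum j ψ = posLin (Z j) ψ := by
  set X := (Z.map Complex.re).map Complex.ofReal with hX
  set Y := (Z.map Complex.im).map Complex.ofReal with hY
  set A := (Z.map Complex.im)⁻¹.map Complex.ofReal with hA
  have hu : IsUnit (Z.map Complex.im).det := hZ.2.det_pos.ne'.isUnit
  have hAY : A * Y = 1 := by
    have h := congrArg Complex.ofRealHom.mapMatrix (nonsing_inv_mul _ hu)
    rwa [map_mul, map_one] at h
  have hYA : Y * A = 1 := mul_eq_one_comm.1 hAY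
  -- the means vanish, so the covariances are the symmetrized second moments
  have hcov2 : ∀ a b, (1 / 2 : ℂ) * (inner ℂ (ket ψ) (ket (quadrature a (quadrature b ψ))) +
      inner ℂ (ket ψ) (ket (quadrature b (quadrature a ψ)))) =
      ((covarianceOfGraph Z a b : ℝ) : ℂ) := by
    intro a b
    have h := congrFun (congrFun hcov a) b
    simpa [covariance, deviation, hmean, ket_add, inner_add_right] using h
  have hnorm : inner ℂ (ket ψ) (ket ψ) = (1 : ℂ) := by
    rw [inner_self_eq_norm_sq_to_K, hψ]; simp
  have hmulmap : ∀ P Q : Matrix (Fin N) (Fin N) ℝ,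
      (P * Q).map Complex.ofReal = P.map Complex.ofReal * Q.map Complex.ofReal :=
    fun P Q => Matrix.map_mul (f := Complex.ofRealHom)
  -- together with the commutation relations they give all the second moments used below
  have hcomm : ∀ j k, inner ℂ (ket ψ) (ket (momentum j (position k ψ))) =
      inner ℂ (ket ψ) (ket (position k (momentum j ψ))) -
        (if j = k then Complex.I else 0) := by
    intro j k
    have h := congrArg (fun T : Module.End ℂ 𝓢(Conf N, ℂ) => T ψ) (momentum_mul_position j k)
    simp only [Module.End.mul_apply, LinearMap.sub_apply, LinearMap.smul_apply,
      Module.End.one_apply] at h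
    rw [h, ket_sub, ket_smul, inner_sub_right, inner_smul_right, hnorm, mul_one]
  have hqq : ∀ k l, inner ℂ (ket ψ) (ket (position k (position l ψ))) = (1 / 2 : ℂ) * A k l := by
    intro k l
    have h := hcov2 (Sum.inl k) (Sum.inl l)
    simp only [quadrature, Sum.elim_inl, covarianceOfGraph, Matrix.smul_apply, fromBlocks_apply₁₁] at h
    have hc : position l (position k ψ) = position k (position l ψ) :=
      congrArg (fun T : Module.End ℂ 𝓢(Conf N, ℂ) => T ψ) (position_comm l k)
    rw [hc] at h
    rw [hA, map_apply]
    push_cast [smul_eq_mul] at h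
    linear_combination h
  have hpp : inner ℂ (ket ψ) (ket (momentum j (momentum j ψ))) =
      (1 / 2 : ℂ) * (X * A * X + Y) j j := by
    have h := hcov2 (Sum.inr j) (Sum.inr j)
    simp only [quadrature, Sum.elim_inr, covarianceOfGraph, Matrix.smul_apply, fromBlocks_apply₂₂] at h
    have e : (X * A * X + Y) j j = (((Z.map Complex.re * (Z.map Complex.im)⁻¹ * Z.map Complex.re
        + Z.map Complex.im) j j : ℝ) : ℂ) := by
      rw [hX, hA, ← hmulmap, ← hmulmap, hY]
      simp
    rw [e]
    push_cast [smul_eq_mul] at h ⊢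
    linear_combination h
  have hqp : ∀ k, inner ℂ (ket ψ) (ket (position k (momentum j ψ))) =
      (1 / 2 : ℂ) * ((A * X) k j + if k = j then Complex.I else 0) := by
    intro k
    have h := hcov2 (Sum.inl k) (Sum.inr j)
    simp only [quadrature, Sum.elim_inr, Sum.elim_inl, covarianceOfGraph, Matrix.smul_apply,
      fromBlocks_apply₁₂, hcomm] at h
    have e : (A * X) k j = ((((Z.map Complex.im)⁻¹ * Z.map Complex.re) k j : ℝ) : ℂ) := by
      rw [hX, hA, ← hmulmap]
      simp
    rw [e]
    simp only [eq_comm (a := j)] at h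
    push_cast [smul_eq_mul] at h ⊢
    linear_combination h
  have hpq : ∀ k, inner ℂ (ket ψ) (ket (momentum j (position k ψ))) =
      (1 / 2 : ℂ) * ((X * A) j k - if k = j then Complex.I else 0) := by
    intro k
    have h := hcov2 (Sum.inr j) (Sum.inl k)
    simp only [quadrature, Sum.elim_inr, Sum.elim_inl, covarianceOfGraph, Matrix.smul_apply,
      fromBlocks_apply₂₁] at h
    have e : (X * A) j k = (((Z.map Complex.re * (Z.map Complex.im)⁻¹) j k : ℝ) : ℂ) := by
      rw [hX, hA, ← hmulmap]
      simp
    rw [e]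
    have h2 := hcomm j k
    simp only [eq_comm (a := j)] at h2
    push_cast [smul_eq_mul] at h ⊢
    linear_combination h + (1 / 2) * h2
  have hid := congrFun (congrFun (covariance_nullifier_identity (X := X) hAY hYA) j) j
  rw [matrix_re_add_im, matrix_re_sub_im] at hid
  have hsymm : ∀ k, Z k j = Z j k := fun k => hZ.1.apply j k
  have hzero : inner ℂ (ket (momentum j ψ - posLin (Z j) ψ))
      (ket (momentum j ψ - posLin (Z j) ψ)) = (0 : ℂ) := by
    rw [ket_sub, inner_sub_left, inner_sub_right, inner_sub_right, inner_momentum, inner_momentum,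
      posLin_sum_inner_left, posLin_sum_inner_left]
    have e1 : inner ℂ (ket ψ) (ket (momentum j (posLin (Z j) ψ))) =
        ∑ k, Z j k * inner ℂ (ket ψ) (ket (momentum j (position k ψ))) := by
      simp [posLin, LinearMap.sum_apply, ket_sum, inner_sum, ket_smul, inner_smul_right]
    have e2 : ∀ k, inner ℂ (ket ψ) (ket (position k (posLin (Z j) ψ))) =
        ∑ l, Z j l * inner ℂ (ket ψ) (ket (position k (position l ψ))) := by
      intro k
      simp [posLin, LinearMap.sum_apply, ket_sum, inner_sum, ket_smul, inner_smul_right]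
    rw [e1]
    simp only [e2, hpp, hpq, hqp, hqq]
    have f1 : ∑ k, Z j k * ((1 / 2 : ℂ) * ((X * A) j k - if k = j then Complex.I else 0)) =
        (1 / 2) * (X * A * Z - Complex.I • Z) j j := by
      simp only [mul_sub, mul_ite, mul_zero, Finset.sum_sub_distrib, Finset.sum_ite_eq',
        Finset.mem_univ, if_true, Matrix.sub_apply, Matrix.smul_apply, smul_eq_mul]
      rw [mul_apply, Finset.mul_sum]
      congr 1
      · refine Finset.sum_congr rfl fun k _ => ?_
        rw [hsymm]; ring
      · ring
    have f2 : ∑ k, conj (Z j k) * ((1 / 2 : ℂ) * ((A * X) k j + if k = j then Complex.I else 0)) =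
        (1 / 2) * (Z.map conj * (A * X) + Complex.I • Z.map conj) j j := by
      simp only [mul_add, mul_ite, mul_zero, Finset.sum_add_distrib, Finset.sum_ite_eq',
        Finset.mem_univ, if_true, Matrix.add_apply, Matrix.smul_apply, smul_eq_mul, map_apply]
      rw [mul_apply, Finset.mul_sum]
      congr 1
      · refine Finset.sum_congr rfl fun k _ => ?_
        rw [map_apply]; ring
      · ring
    have f3 : ∑ k, conj (Z j k) * ∑ l, Z j l * ((1 / 2 : ℂ) * A k l) =
        (1 / 2) * (Z.map conj * A * Z) j j := by
      rw [mul_assoc, mul_apply, Finset.mul_sum]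
      refine Finset.sum_congr rfl fun k _ => ?_
      rw [mul_apply, map_apply, Finset.mul_sum, Finset.mul_sum, Finset.mul_sum]
      refine Finset.sum_congr rfl fun l _ => ?_
      rw [hsymm]; ring
    rw [f1, f2, f3]
    simp only [Matrix.sub_apply, Matrix.add_apply, Matrix.zero_apply] at hid ⊢
    linear_combination (1 / 2) * hid
  exact sub_eq_zero.1 (ket_eq_zero (inner_self_eq_zero.1 hzero))

/-! ### Stationary pure states -/

theorem solvesMasterEquation_const_iff {H L Lad : 𝓢(Conf N, ℂ) →ₗ[ℂ] 𝓢(Conf N, ℂ)}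
    {ρ : Hilb N →L[ℂ] Hilb N} :
    SolvesMasterEquation H L Lad (fun _ => ρ) ↔ ∀ φ χ, lindbladForm H L Lad ρ φ χ = 0 := by
  constructor
  · intro h φ χ
    exact (h φ χ 0).unique (hasDerivAt_const _ _)
  · intro h φ χ t
    rw [h]
    exact hasDerivAt_const _ _

theorem isDensityOperator_rankOne {v : Hilb N} (hv : ‖v‖ = 1) :
    IsDensityOperator (InnerProductSpace.rankOne ℂ v v) := by
  refine ⟨InnerProductSpace.isPositive_rankOne_self v, fun ι b => ?_⟩
  have h := b.hasSum_inner_mul_inner v v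
  rw [inner_self_eq_norm_sq_to_K, hv] at h
  simp only [InnerProductSpace.rankOne_apply, inner_smul_right]
  simpa using h

namespace PassiveLocalSystem

variable (S : PassiveLocalSystem N)

theorem isSteadyState_rankOne {ψ : 𝓢(Conf N, ℂ)} (hψ : ‖ket ψ‖ = 1) (hL : S.lindblad ψ = 0)
    {E : ℂ} (hH : S.hamiltonian ψ = E • ψ) :
    S.IsSteadyState (InnerProductSpace.rankOne ℂ (ket ψ) (ket ψ)) := by
  refine ⟨isDensityOperator_rankOne hψ, solvesMasterEquation_const_iff.2 fun φ χ => ?_⟩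
  have hnorm : inner ℂ (ket ψ) (ket ψ) = (1 : ℂ) := by
    rw [inner_self_eq_norm_sq_to_K, hψ]; simp
  have hE : conj E = E := by
    have h := S.inner_hamiltonian ψ ψ
    rw [hH, ket_smul, inner_smul_left, inner_smul_right, hnorm, mul_one, mul_one] at h
    exact h
  have h1 : ∀ φ, inner ℂ (ket (S.lindbladAdjoint φ)) (ket ψ) = (0 : ℂ) := by
    intro φ
    rw [inner_lindbladAdjoint, hL, ket_zero, inner_zero_right]
  have h2 : ∀ χ, inner ℂ (ket ψ) (ket (S.lindbladAdjoint χ)) = (0 : ℂ) := by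
    intro φ
    rw [← inner_lindblad, hL, ket_zero, inner_zero_left]
  have h3 : inner ℂ (ket (S.hamiltonian φ)) (ket ψ) = E * inner ℂ (ket φ) (ket ψ) := by
    rw [inner_hamiltonian, hH, ket_smul, inner_smul_right]
  have h4 : inner ℂ (ket ψ) (ket (S.hamiltonian χ)) = E * inner ℂ (ket ψ) (ket χ) := by
    rw [← inner_hamiltonian, hH, ket_smul, inner_smul_left, hE]
  simp only [lindbladForm, InnerProductSpace.rankOne_apply, inner_smul_right, h1, h2, h3, h4]
  ring

/-- A stationary pure state on which the Lindblad operator has mean value zero is annihilated by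
the Lindblad operator and is an eigenvector of the Hamiltonian. -/
theorem eigen_of_isSteadyState {ψ : 𝓢(Conf N, ℂ)} (hψ : ‖ket ψ‖ = 1)
    (hmean : inner ℂ (ket ψ) (ket (S.lindblad ψ)) = (0 : ℂ))
    (hS : S.IsSteadyState (InnerProductSpace.rankOne ℂ (ket ψ) (ket ψ))) :
    S.lindblad ψ = 0 ∧ ∃ E : ℂ, S.hamiltonian ψ = E • ψ := by
  have hform := solvesMasterEquation_const_iff.1 hS.2
  have hnorm : inner ℂ (ket ψ) (ket ψ) = (1 : ℂ) := by
    rw [inner_self_eq_norm_sq_to_K, hψ]; simp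
  have hmean' : inner ℂ (ket (S.lindblad ψ)) (ket ψ) = (0 : ℂ) := by
    rw [← inner_conj_symm, hmean, map_zero]
  simp only [lindbladForm, InnerProductSpace.rankOne_apply, inner_smul_right] at hform
  have hL : S.lindblad ψ = 0 := by
    -- on `φ = χ = L ψ` only the term `L ρ L*` of the generator survives
    have h := hform (S.lindblad ψ) (S.lindblad ψ)
    rw [hmean, hmean', inner_lindbladAdjoint, ← inner_lindblad] at h
    simp only [mul_zero, zero_mul, sub_zero, zero_add, mul_eq_zero, or_self] at h
    exact ket_eq_zero (inner_self_eq_zero.1 h)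
  refine ⟨hL, inner ℂ (ket ψ) (ket (S.hamiltonian ψ)), ?_⟩
  -- with `L ψ = 0`, testing on `χ = ψ` and on the component of `H ψ` orthogonal to `ψ` shows that
  -- this component vanishes
  have h0 : ket (S.hamiltonian ψ - (inner ℂ (ket ψ) (ket (S.hamiltonian ψ)) : ℂ) • ψ) = 0 := by
    set k := S.hamiltonian ψ - (inner ℂ (ket ψ) (ket (S.hamiltonian ψ)) : ℂ) • ψ with hk
    have h := hform k ψ
    have h1 : ∀ φ, inner ℂ (ket (S.lindbladAdjoint φ)) (ket ψ) = (0 : ℂ) := by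
      intro φ
      rw [inner_lindbladAdjoint, hL, ket_zero, inner_zero_right]
    rw [h1, h1, hL, map_zero, ket_zero, inner_zero_right, hnorm, inner_hamiltonian] at h
    rw [← inner_self_eq_zero (𝕜 := ℂ)]
    have e : inner ℂ (ket k) (ket k) = inner ℂ (ket k) (ket (S.hamiltonian ψ)) -
        inner ℂ (ket ψ) (ket (S.hamiltonian ψ)) * inner ℂ (ket k) (ket ψ) := by
      rw [← inner_smul_right, ← inner_sub_right, ← ket_smul, ← ket_sub]
    rw [e]
    linear_combination Complex.I * h +
      (inner ℂ (ket k) (ket (S.hamiltonian ψ)) -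
        inner ℂ (ket ψ) (ket (S.hamiltonian ψ)) * inner ℂ (ket k) (ket ψ)) * Complex.I_sq
  exact sub_eq_zero.1 (ket_eq_zero h0)

end PassiveLocalSystem

/-! ### The Hamiltonian on a Gaussian state -/

theorem momLin_of_nullifier {Z : Matrix (Fin N) (Fin N) ℂ} (hZ : Z.IsSymm) {ψ : 𝓢(Conf N, ℂ)}
    (hψ : ∀ j, momentum j ψ = posLin (Z j) ψ) (u : Fin N → ℂ) :
    momLin u ψ = posLin (Z *ᵥ u) ψ := by
  have h := sum_smul_posLin Z u
  rw [hZ.eq] at h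
  rw [← h]
  simp [momLin, LinearMap.sum_apply, hψ]

/-- The point `x` of the configuration space as a complex vector. -/
def cvec (x : Conf N) : Fin N → ℂ := fun k => (x k : ℂ)

theorem posLin_apply_cvec (u : Fin N → ℂ) (φ : 𝓢(Conf N, ℂ)) (x : Conf N) :
    posLin u φ x = (u ⬝ᵥ cvec x) * φ x := posLin_apply u φ x

/-- On the Gaussian wave function of graph matrix `Z`, the Hamiltonian acts as multiplication by
the quadratic polynomial `(1/2) xᵀ (R + Z R Z) x - (i/2) tr (Z R)`. -/
theorem quadHam_apply_of_nullifier {Z R : Matrix (Fin N) (Fin N) ℂ} (hZ : Z.IsSymm)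
    (hR : R.IsSymm) {ψ : 𝓢(Conf N, ℂ)} (hψ : ∀ j, momentum j ψ = posLin (Z j) ψ) (x : Conf N) :
    quadHam R ψ x = ((1 / 2) * (cvec x ⬝ᵥ ((R + Z * R * Z) *ᵥ cvec x))
      - (Complex.I / 2) * (Z * R).trace) * ψ x := by
  have h1 : ∀ j, momentum j (momLin (R j) ψ) =
      posLin (Z *ᵥ R j) (posLin (Z j) ψ) - (Complex.I * (Z *ᵥ R j) j) • ψ := by
    intro j
    rw [momLin_of_nullifier hZ hψ]
    have h := congrArg (fun T : Module.End ℂ 𝓢(Conf N, ℂ) => T ψ)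
      (momentum_mul_posLin j (Z *ᵥ R j))
    simpa [Module.End.mul_apply, hψ] using h
  have h2 : quadHam R ψ x = (1 / 2) * ∑ j, ((x j : ℂ) * ((R j ⬝ᵥ cvec x) * ψ x) +
      (((Z *ᵥ R j) ⬝ᵥ cvec x) * ((Z j ⬝ᵥ cvec x) * ψ x) - Complex.I * (Z *ᵥ R j) j * ψ x)) := by
    simp [quadHam, LinearMap.sum_apply, Module.End.mul_apply, h1, position_apply,
      posLin_apply_cvec]
  have e1 : ∀ j, Z *ᵥ R j = (Z * R).col j := by
    intro j
    ext k
    simp only [mulVec, dotProduct, col_apply, mul_apply]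
    exact Finset.sum_congr rfl fun l _ => by rw [hR.apply]
  have e2 : ∀ j, (Z *ᵥ R j) ⬝ᵥ cvec x = (R *ᵥ (Z *ᵥ cvec x)) j := by
    intro j
    rw [dotProduct_comm, dotProduct_mulVec, ← mulVec_transpose, hZ.eq, dotProduct_comm]
    rfl
  rw [h2]
  have e3 : cvec x ⬝ᵥ ((R + Z * R * Z) *ᵥ cvec x) =
      ∑ j, ((x j : ℂ) * (R j ⬝ᵥ cvec x) + (R *ᵥ (Z *ᵥ cvec x)) j * (Z j ⬝ᵥ cvec x)) := by
    rw [add_mulVec, dotProduct_add, Finset.sum_add_distrib]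
    congr 1
    rw [mul_assoc, ← mulVec_mulVec, ← mulVec_mulVec, dotProduct_mulVec, ← mulVec_transpose, hZ.eq,
      dotProduct_comm]
    rfl
  have e4 : (Z * R).trace = ∑ j, (Z *ᵥ R j) j := by
    simp only [e1, trace, diag_apply, col_apply]
  rw [e3, e4]
  simp only [e2, Finset.mul_sum, Finset.sum_mul, ← Finset.sum_sub_distrib, sub_mul]
  refine Finset.sum_congr rfl fun j _ => ?_
  ring

/-- A complex symmetric matrix is determined by its quadratic form on real vectors. -/
theorem eq_zero_of_quadForm {M : Matrix (Fin N) (Fin N) ℂ} (hM : M.IsSymm)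
    (h : ∀ x : Conf N, cvec x ⬝ᵥ (M *ᵥ cvec x) = 0) : M = 0 := by
  have hs : ∀ j : Fin N, cvec (EuclideanSpace.single j (1 : ℝ)) = Pi.single j 1 := by
    intro j
    ext k
    by_cases hjk : k = j <;> simp [cvec, hjk]
  have hadd : ∀ x y : Conf N, cvec (x + y) = cvec x + cvec y := by
    intro x y; ext k; simp [cvec]
  have hd : ∀ j, M j j = 0 := by
    intro j
    have := h (EuclideanSpace.single j 1)
    simpa [hs] using this
  ext j k
  have := h (EuclideanSpace.single j 1 + EuclideanSpace.single k 1)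
  rw [hadd, hs, hs] at this
  simp only [mulVec_add, dotProduct_add, add_dotProduct, mulVec_single_one, single_dotProduct,
    col_apply, one_mul, hd, hM.apply j k] at this
  rw [Matrix.zero_apply]
  linear_combination (1 / 2) * this

/-! ### Completeness of polynomial multiples of a Gaussian wave function -/

open scoped FourierTransform ContDiff in
/-- Injectivity of the Fourier transform on `L¹(ℝ^N)`. -/
theorem ae_eq_zero_of_integral_exp_eq_zero {h : Conf N → ℂ} (hint : Integrable h volume)
    (h0 : ∀ t : Conf N, ∫ x, Complex.exp (Complex.I * (inner ℝ t x : ℝ)) * h x = 0) :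
    ∀ᵐ x, h x = 0 := by
  have hF : 𝓕 h = 0 := by
    ext w
    rw [Real.fourier_eq', Pi.zero_apply, ← h0 (-(2 * Real.pi) • w)]
    refine integral_congr_ae (Filter.Eventually.of_forall fun x => ?_)
    simp only [smul_eq_mul, inner_smul_left, real_inner_comm w x]
    congr 2
    push_cast
    simp
    ring
  -- by Parseval, `h` integrates to zero against every Schwartz function
  have hS : ∀ g : 𝓢(Conf N, ℂ), ∫ x, h x * g x = 0 := by
    intro g
    have hflip := VectorFourier.integral_bilin_fourierIntegral_eq_flip (μ := volume)
      (ν := volume) (L := innerₗ (Conf N)) (f := h) (g := (𝓕⁻ g : 𝓢(Conf N, ℂ)))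
      (ContinuousLinearMap.mul ℂ ℂ) Real.continuous_fourierChar continuous_inner hint
      (SchwartzMap.integrable _)
    have e1 : VectorFourier.fourierIntegral Real.fourierChar volume (innerₗ (Conf N)) h = 0 := hF
    have e2 : VectorFourier.fourierIntegral Real.fourierChar volume (innerₗ (Conf N)).flip
        ((𝓕⁻ g : 𝓢(Conf N, ℂ)) : Conf N → ℂ) = g := by
      rw [flip_innerₗ]
      change 𝓕 ((𝓕⁻ g : 𝓢(Conf N, ℂ)) : Conf N → ℂ) = g
      rw [← SchwartzMap.fourier_coe, FourierTransform.fourier_fourierInv_eq]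
    rw [e1, e2] at hflip
    simpa using hflip.symm
  refine ae_eq_zero_of_integral_contDiff_smul_eq_zero hint.locallyIntegrable fun g hg hc => ?_
  have hg₁ : HasCompactSupport (Complex.ofRealCLM ∘ g) := hc.comp_left rfl
  have hg₂ : ContDiff ℝ ∞ (Complex.ofRealCLM ∘ g) := by fun_prop
  rw [← hS (hg₁.toSchwartzMap hg₂)]
  refine integral_congr_ae (Filter.Eventually.of_forall fun x => ?_)
  simp [mul_comm]

theorem posLin_pow_apply (u : Fin N → ℂ) (n : ℕ) (φ : 𝓢(Conf N, ℂ)) (x : Conf N) :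
    (posLin u ^ n) φ x = (u ⬝ᵥ cvec x) ^ n * φ x := by
  induction n with
  | zero => simp
  | succ n ih => rw [pow_succ', Module.End.mul_apply, posLin_apply_cvec, ih]; ring

theorem dotProduct_cvec (t x : Conf N) : cvec t ⬝ᵥ cvec x = ((inner ℝ t x : ℝ) : ℂ) := by
  simp [dotProduct, cvec, PiLp.inner_apply, mul_comm]

/-- If all the moments of `h` in the direction `t` vanish and `h` decays exponentially in this
direction, then the Fourier transform of `h` vanishes at `t`. -/
theorem integral_exp_eq_zero_of_moments {h : Conf N → ℂ} {t : Conf N}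
    (hm : AEStronglyMeasurable h volume)
    (hbound : Integrable (fun x => Real.exp |inner ℝ t x| * ‖h x‖) volume)
    (hpow : ∀ n : ℕ, ∫ x, ((inner ℝ t x : ℝ) : ℂ) ^ n * h x = 0) :
    ∫ x, Complex.exp (Complex.I * (inner ℝ t x : ℝ)) * h x = 0 := by
  -- the terms of the exponential series, integrated termwise by dominated convergence
  set F : ℕ → Conf N → ℂ :=
    fun n x => (Complex.I ^ n / (n.factorial : ℂ)) * (((inner ℝ t x : ℝ) : ℂ) ^ n * h x) with hF
  have hmeas : ∀ n, AEStronglyMeasurable (F n) volume := fun n => by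
    refine AEStronglyMeasurable.const_mul (AEStronglyMeasurable.mul ?_ hm) _
    exact (by fun_prop :
      Continuous fun x : Conf N => ((inner ℝ t x : ℝ) : ℂ) ^ n).aestronglyMeasurable
  have hnorm : ∀ n x, ‖F n x‖ ≤ |inner ℝ t x| ^ n / (n.factorial : ℝ) * ‖h x‖ := fun n x => by
    simp only [hF, norm_mul, norm_div, norm_pow, Complex.norm_I, one_pow, Complex.norm_real,
      Real.norm_eq_abs, Complex.norm_natCast]
    exact le_of_eq (by ring)
  have hlim : ∀ x, HasSum (fun n => F n x)
      (Complex.exp (Complex.I * (inner ℝ t x : ℝ)) * h x) := fun x => by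
    have h1 : HasSum (fun n : ℕ => (Complex.I * (inner ℝ t x : ℝ)) ^ n / (n.factorial : ℂ))
        (Complex.exp (Complex.I * (inner ℝ t x : ℝ))) := by
      rw [Complex.exp_eq_exp_ℂ]
      exact NormedSpace.expSeries_div_hasSum_exp _
    have e : (fun n => F n x) =
        fun n : ℕ => (Complex.I * (inner ℝ t x : ℝ)) ^ n / (n.factorial : ℂ) * h x := by
      funext n
      simp only [hF, mul_pow]
      ring
    rw [e]
    exact h1.mul_right (h x)
  have htsum : Integrable
      (fun x => ∑' n : ℕ, |inner ℝ t x| ^ n / (n.factorial : ℝ) * ‖h x‖) volume := by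
    refine hbound.congr (Filter.Eventually.of_forall fun x => ?_)
    simp only [tsum_mul_right]
    rw [Real.exp_eq_exp_ℝ, NormedSpace.exp_eq_tsum_div]
  have hbsum : ∀ x, Summable fun n : ℕ => |inner ℝ t x| ^ n / (n.factorial : ℝ) * ‖h x‖ :=
    fun x => (Real.summable_pow_div_factorial _).mul_right _
  have hF0 : ∀ n, ∫ x, F n x = 0 := fun n => by
    simp only [hF]
    rw [integral_const_mul, hpow, mul_zero]
  clear_value F
  have hsum : HasSum (fun n => ∫ x, F n x)
      (∫ x, Complex.exp (Complex.I * (inner ℝ t x : ℝ)) * h x) :=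
    hasSum_integral_of_dominated_convergence
      (fun n x => |inner ℝ t x| ^ n / (n.factorial : ℝ) * ‖h x‖) hmeas
      (fun n => Filter.Eventually.of_forall (hnorm n)) (Filter.Eventually.of_forall hbsum) htsum
      (Filter.Eventually.of_forall hlim)
  simp only [hF0] at hsum
  exact hsum.unique hasSum_zero

/-- If a nowhere vanishing Schwartz function decays faster than every exponential in the `L²` sense,
then its products with polynomials are total in `L²`. -/
theorem eq_zero_of_orthogonal {ψ : 𝓢(Conf N, ℂ)} (hψ0 : ∀ x, ψ x ≠ 0)
    (hexp : ∀ t : Conf N, MemLp (fun x => Real.exp (inner ℝ t x) * ‖ψ x‖) 2 volume)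
    {D : Set 𝓢(Conf N, ℂ)} (hD : ψ ∈ D) (hq : ∀ u, ∀ φ ∈ D, posLin u φ ∈ D)
    {v : Hilb N} (hv : ∀ φ ∈ D, inner ℂ (ket φ) v = 0) : v = 0 := by
  have hvm : MemLp v 2 volume := Lp.memLp v
  have hcψ : MemLp (fun x => conj (ψ x)) 2 volume := by
    refine (ψ.memLp 2 volume).mono
      (Complex.continuous_conj.comp_aestronglyMeasurable (ψ.memLp 2 volume).1) ?_
    exact Filter.Eventually.of_forall fun x => by simp
  have hint : Integrable (fun x => conj (ψ x) * v x) volume := hcψ.integrable_mul hvm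
  have hmem : ∀ (t : Conf N) (m : ℕ), (posLin (cvec t) ^ m) ψ ∈ D := by
    intro t m
    induction m with
    | zero => simpa using hD
    | succ m ih => rw [pow_succ', Module.End.mul_apply]; exact hq _ _ ih
  have hpow : ∀ (t : Conf N) (n : ℕ),
      ∫ x, ((inner ℝ t x : ℝ) : ℂ) ^ n * (conj (ψ x) * v x) = 0 := by
    intro t n
    rw [← hv _ (hmem t n), L2.inner_def]
    refine integral_congr_ae ?_
    filter_upwards [SchwartzMap.coeFn_toLp ((posLin (cvec t) ^ n) ψ) 2 volume] with x hx
    rw [ket, hx, posLin_pow_apply, dotProduct_cvec]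
    simp only [RCLike.inner_apply, map_mul, map_pow, Complex.conj_ofReal]
    ring
  have hbound : ∀ t : Conf N,
      Integrable (fun x => Real.exp |inner ℝ t x| * ‖conj (ψ x) * v x‖) volume := by
    intro t
    have h1 := (hexp t).integrable_mul hvm.norm
    have h2 := (hexp (-t)).integrable_mul hvm.norm
    refine (h1.add h2).mono' ?_ (Filter.Eventually.of_forall fun x => ?_)
    · refine AEStronglyMeasurable.mul ?_ hint.1.norm
      exact (by fun_prop :
        Continuous fun x : Conf N => Real.exp |inner ℝ t x|).aestronglyMeasurable
    · have e1 : Real.exp |inner ℝ t x| ≤ Real.exp (inner ℝ t x) + Real.exp (-inner ℝ t x) := by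
        rcases abs_choice (inner ℝ t x) with e | e <;> rw [e] <;>
          linarith [Real.exp_pos (inner ℝ t x), Real.exp_pos (-inner ℝ t x)]
      rw [Real.norm_of_nonneg (by positivity)]
      simp only [norm_mul, RCLike.norm_conj, Pi.add_apply, Pi.mul_apply, inner_neg_left]
      calc _ ≤ (Real.exp (inner ℝ t x) + Real.exp (-inner ℝ t x)) * (‖ψ x‖ * ‖v x‖) :=
            mul_le_mul_of_nonneg_right e1 (by positivity)
        _ = _ := by ring
  have hae := ae_eq_zero_of_integral_exp_eq_zero hint fun t =>
    integral_exp_eq_zero_of_moments hint.1 (hbound t) (hpow t)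
  rw [Lp.eq_zero_iff_ae_eq_zero]
  filter_upwards [hae] with x hx
  simpa [hψ0 x] using hx

/-! ### Explicit form of the wave function -/

theorem cvec_add_smul (x y : Conf N) (t : ℝ) : cvec (x + t • y) = cvec x + (t : ℂ) • cvec y := by
  ext k; simp [cvec]

theorem cvec_single (j : Fin N) : cvec (EuclideanSpace.single j (1 : ℝ)) = Pi.single j 1 := by
  ext k
  by_cases hjk : k = j <;> simp [cvec, hjk]

/-- A Gaussian wave function annihilated by the operators `p_j - ∑ Z_{jk} q_k` is a multiple of
`exp ((i/2) xᵀ Z x)`. -/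
theorem wave_eq_of_nullifier {Z : Matrix (Fin N) (Fin N) ℂ}
    {ψ : 𝓢(Conf N, ℂ)} (hg : IsGaussianWave ψ) (hψ : ∀ j, momentum j ψ = posLin (Z j) ψ) :
    ∃ c : ℂ, ∀ x, ψ x = Complex.exp ((Complex.I / 2) * (cvec x ⬝ᵥ (Z *ᵥ cvec x)) + c) := by
  obtain ⟨M, b, c, hM, hform⟩ := hg
  have hform' : ∀ x, ψ x =
      Complex.exp (-(1 / 2) * (cvec x ⬝ᵥ (M *ᵥ cvec x)) + b ⬝ᵥ cvec x + c) := by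
    intro x
    rw [hform x]
    simp only [dotProduct, mulVec, cvec, Finset.mul_sum, mul_assoc]
  have hderiv : ∀ (x : Conf N) (j : Fin N),
      lineDeriv ℝ ψ x (EuclideanSpace.single j 1) = (-(M *ᵥ cvec x) j + b j) * ψ x := by
    intro x j
    have hq : ∀ t : ℝ, ψ (x + t • EuclideanSpace.single j 1) =
        Complex.exp ((-(1 / 2) * (cvec x ⬝ᵥ (M *ᵥ cvec x)) + b ⬝ᵥ cvec x + c)
          + (t : ℂ) * (-(M *ᵥ cvec x) j + b j) + (t : ℂ) ^ 2 * (-(1 / 2) * M j j)) := by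
      intro t
      have e : cvec x ⬝ᵥ M.col j = (M *ᵥ cvec x) j := by
        rw [← mulVec_single_one, dotProduct_mulVec, ← mulVec_transpose, hM.eq, dotProduct_single, mul_one]
      rw [hform', cvec_add_smul, cvec_single]
      congr 1
      simp only [mulVec_add, mulVec_smul, dotProduct_add, add_dotProduct, dotProduct_smul,
        smul_dotProduct, e, smul_eq_mul, single_dotProduct, dotProduct_single, one_mul, mul_one,
        mulVec_single_one, col_apply]
      ring
    have hof : HasDerivAt (fun t : ℝ => (t : ℂ)) 1 0 := Complex.ofRealCLM.hasDerivAt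
    have hd : HasDerivAt (fun t : ℝ => ψ (x + t • EuclideanSpace.single j 1))
        ((-(M *ᵥ cvec x) j + b j) * ψ x) 0 := by
      simp only [hq]
      have h1 := (((hof.mul_const (-(M *ᵥ cvec x) j + b j)).const_add
        (-(1 / 2) * (cvec x ⬝ᵥ (M *ᵥ cvec x)) + b ⬝ᵥ cvec x + c)).add
        ((hof.pow 2).mul_const (-(1 / 2) * M j j))).cexp
      refine h1.congr_deriv ?_
      rw [hform' x]
      simp
      ring
    exact hd.deriv
  have hrel : ∀ (x : Conf N) (j : Fin N),
      -Complex.I * (-(M *ᵥ cvec x) j + b j) = (Z *ᵥ cvec x) j := by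
    intro x j
    have h1 := congrArg (fun φ : 𝓢(Conf N, ℂ) => φ x) (hψ j)
    simp only [momentum_apply, posLin_apply_cvec, hderiv] at h1
    have h0 : ψ x ≠ 0 := by rw [hform']; exact Complex.exp_ne_zero _
    exact mul_right_cancel₀ h0 (by rw [mul_assoc]; exact h1)
  have hb : b = 0 := by
    ext j
    have h1 := hrel 0 j
    have h2 : cvec (0 : Conf N) = 0 := by ext k; simp [cvec]
    simpa [h2] using h1
  refine ⟨c, fun x => ?_⟩
  rw [hform', hb]
  have hZ : Z *ᵥ cvec x = Complex.I • (M *ᵥ cvec x) := by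
    ext j
    rw [← hrel x j, hb]
    simp
  rw [hZ, dotProduct_smul, zero_dotProduct, smul_eq_mul]
  congr 1
  linear_combination (-(1 / 2) * (cvec x ⬝ᵥ M *ᵥ cvec x)) * Complex.I_sq

/-- Multiplying a Gaussian wave function by a real exponential amounts to a translation, so that
the product is again square-integrable. -/
theorem memLp_exp_mul_wave {Z : Matrix (Fin N) (Fin N) ℂ} (hZ : IsGraphMatrix Z)
    {ψ : 𝓢(Conf N, ℂ)} {c : ℂ}
    (hψ : ∀ x, ψ x = Complex.exp ((Complex.I / 2) * (cvec x ⬝ᵥ (Z *ᵥ cvec x)) + c))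
    (t : Conf N) : MemLp (fun x => Real.exp (inner ℝ t x) * ‖ψ x‖) 2 volume := by
  set Y := Z.map Complex.im with hY
  have hYs : Y.IsSymm := by
    ext j k
    simp [hY, hZ.1.apply]
  have hu : IsUnit Y.det := hZ.2.det_pos.ne'.isUnit
  have hnorm : ∀ x : Conf N, ‖ψ x‖ = Real.exp (-(1 / 2) * (x.ofLp ⬝ᵥ (Y *ᵥ x.ofLp)) + c.re) := by
    intro x
    rw [hψ, Complex.norm_exp]
    congr 1
    have e : (cvec x ⬝ᵥ (Z *ᵥ cvec x)).im = x.ofLp ⬝ᵥ (Y *ᵥ x.ofLp) := by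
      simp [dotProduct, mulVec, cvec, hY, Complex.im_sum, Finset.mul_sum]
    rw [← e]
    simp
  -- completing the square in `t ⬝ x - (1/2) xᵀ Y x` shifts the center of the Gaussian to `Y⁻¹ t`
  set s : Conf N := WithLp.toLp 2 (Y⁻¹ *ᵥ t.ofLp) with hs
  have hYsv : Y *ᵥ s.ofLp = t.ofLp := by
    rw [hs, mulVec_mulVec, mul_nonsing_inv _ hu, one_mulVec]
  have hmp : MemLp (fun x => ‖ψ (x - s)‖) 2 volume :=
    ((ψ.memLp 2 volume).comp_measurePreserving (measurePreserving_sub_right volume s)).norm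
  refine (hmp.const_mul (Real.exp ((1 / 2) * (s.ofLp ⬝ᵥ t.ofLp)))).congr_norm ?_ ?_
  · exact (by fun_prop : Continuous fun x => Real.exp (inner ℝ t x) * ‖ψ x‖).aestronglyMeasurable
  · refine Filter.Eventually.of_forall fun x => ?_
    simp only
    congr 1
    rw [hnorm, hnorm, ← Real.exp_add, ← Real.exp_add]
    congr 1
    have e1 : inner ℝ t x = x.ofLp ⬝ᵥ t.ofLp := by
      simp [PiLp.inner_apply, dotProduct]
    have e2 : s.ofLp ⬝ᵥ (Y *ᵥ x.ofLp) = x.ofLp ⬝ᵥ t.ofLp := by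
      rw [dotProduct_mulVec, ← mulVec_transpose, hYs.eq, hYsv, dotProduct_comm]
    rw [e1, WithLp.ofLp_sub, mulVec_sub, dotProduct_sub, sub_dotProduct, sub_dotProduct, e2, hYsv]
    ring

/-! ### Positive operators and traces over finite-dimensional subspaces -/

theorem _root_.ContinuousLinearMap.IsPositive.apply_eq_zero_of_inner_eq_zero {E : Type*}
    [NormedAddCommGroup E] [InnerProductSpace ℂ E] [CompleteSpace E] {T : E →L[ℂ] E}
    (hT : T.IsPositive)
    {v : E} (hv : inner ℂ v (T v) = (0 : ℂ)) : T v = 0 := by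
  have hsymm : ∀ x y, inner ℂ x (T y) = inner ℂ (T x) y := fun x y =>
    (hT.inner_left_eq_inner_right x y).symm
  have key : ∀ t : ℝ, 0 ≤ 2 * t * ‖T v‖ ^ 2 + t ^ 2 * (inner ℂ (T v) (T (T v)) : ℂ).re := by
    intro t
    have h := hT.re_inner_nonneg_right (v + (t : ℂ) • T v)
    have e : inner ℂ (v + (t : ℂ) • T v) (T (v + (t : ℂ) • T v)) =
        ((2 * t * ‖T v‖ ^ 2 : ℝ) : ℂ) + ((t ^ 2 : ℝ) : ℂ) * inner ℂ (T v) (T (T v)) := by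
      simp only [map_add, map_smul, inner_add_left, inner_add_right, inner_smul_left,
        inner_smul_right, hv, Complex.conj_ofReal, hsymm v (T v), inner_self_eq_norm_sq_to_K]
      push_cast
      simp
      ring
    rw [e] at h
    simpa [← Complex.ofReal_pow] using h
  have hnn : 0 ≤ (inner ℂ (T v) (T (T v)) : ℂ).re := hT.re_inner_nonneg_right (T v)
  by_contra hne
  have hpos : 0 < ‖T v‖ ^ 2 := by positivity
  set a := ‖T v‖ ^ 2
  set b := (inner ℂ (T v) (T (T v)) : ℂ).re
  -- the quadratic polynomial `2 t a + t² b` is negative at `t = -a / (b + 1)`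
  have h := key (-(a / (b + 1)))
  have hb : 0 < b + 1 := by linarith
  have e : 2 * -(a / (b + 1)) * a + (-(a / (b + 1))) ^ 2 * b =
      -(a ^ 2 * (b + 2) / (b + 1) ^ 2) := by
    field_simp
    ring
  rw [e] at h
  have : 0 < a ^ 2 * (b + 2) / (b + 1) ^ 2 := by positivity
  linarith

/-- A finite family of Schwartz functions is an orthonormal basis of the subspace `D`, for the
inner product of `L²`. -/
structure IsKetBasis {ι : Type} [Fintype ι] (D : Submodule ℂ 𝓢(Conf N, ℂ))
    (e : ι → 𝓢(Conf N, ℂ)) : Prop where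
  mem : ∀ i, e i ∈ D
  expand : ∀ φ ∈ D, φ = ∑ i, (inner ℂ (ket (e i)) (ket φ) : ℂ) • e i

theorem exists_isKetBasis (D : Submodule ℂ 𝓢(Conf N, ℂ)) [FiniteDimensional ℂ D] :
    ∃ (n : ℕ) (e : Fin n → 𝓢(Conf N, ℂ)), IsKetBasis D e := by
  let F := D.map (ketₗ (N := N))
  let b := stdOrthonormalBasis ℂ F
  have hb : ∀ i, ∃ φ ∈ D, ket φ = (b i : Hilb N) := fun i => (b i).2
  choose e he hk using hb
  refine ⟨_, e, he, fun φ hφ => ket_injective ?_⟩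
  have hmem : ket φ ∈ F := ⟨φ, hφ, rfl⟩
  have h := congrArg (Subtype.val) (b.sum_repr' ⟨ket φ, hmem⟩)
  simp only [Submodule.coe_sum, Submodule.coe_smul, Submodule.coe_inner] at h
  rw [ket_sum]
  simp only [ket_smul, hk]
  exact h.symm

/-- Cyclicity of the trace for a pair of mutually adjoint operators between two finite-dimensional
subspaces. -/
theorem sum_inner_cyclic {ι κ : Type} [Fintype ι] [Fintype κ] {D F : Submodule ℂ 𝓢(Conf N, ℂ)}
    {e : ι → 𝓢(Conf N, ℂ)} {f : κ → 𝓢(Conf N, ℂ)} (he : IsKetBasis D e) (hf : IsKetBasis F f)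
    {A B C : 𝓢(Conf N, ℂ) →ₗ[ℂ] 𝓢(Conf N, ℂ)}
    (hadj : ∀ φ χ, inner ℂ (ket (A φ)) (ket χ) = inner ℂ (ket φ) (ket (B χ)))
    (hA : ∀ φ ∈ D, A φ ∈ F) (hB : ∀ φ ∈ F, B φ ∈ D) (ρ : Hilb N →L[ℂ] Hilb N) :
    ∑ i, inner ℂ (ket (C (A (e i)))) (ρ (ket (e i))) =
      ∑ j, inner ℂ (ket (C (f j))) (ρ (ket (B (f j)))) := by
  have h1 : ∀ i, inner ℂ (ket (C (A (e i)))) (ρ (ket (e i))) =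
      ∑ j, inner ℂ (ket (A (e i))) (ket (f j)) * inner ℂ (ket (C (f j))) (ρ (ket (e i))) := by
    intro i
    conv_lhs => rw [hf.expand _ (hA _ (he.mem i))]
    simp only [map_sum, map_smul, ket_sum, ket_smul, sum_inner, inner_smul_left, inner_conj_symm]
  have h2 : ∀ j, inner ℂ (ket (C (f j))) (ρ (ket (B (f j)))) =
      ∑ i, inner ℂ (ket (A (e i))) (ket (f j)) * inner ℂ (ket (C (f j))) (ρ (ket (e i))) := by
    intro j
    conv_lhs => rw [he.expand _ (hB _ (hf.mem j))]
    simp only [map_sum, map_smul, ket_sum, ket_smul, inner_sum, inner_smul_right, hadj]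
  simp only [h1, h2]
  exact Finset.sum_comm

/-! ### Steady states of a lossy system -/

namespace PassiveLocalSystem

variable (S : PassiveLocalSystem N)

open scoped ComplexOrder in
/-- Let `D 0 ⊆ D 1 ⊆ …` be finite-dimensional spaces such that the Hamiltonian preserves each of
them, the Lindblad operator lowers the index by one and its adjoint raises it by one. For a positive
stationary `ρ`, the trace of `L ρ L*` over `D n` does not depend on `n` and is zero for `n = 0`;
by positivity, `ρ L*` vanishes on every `D n`. -/
theorem apply_lindbladAdjoint_eq_zero {ρ : Hilb N →L[ℂ] Hilb N} (hρ : ρ.IsPositive)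
    (hform : ∀ φ χ, lindbladForm S.hamiltonian S.lindblad S.lindbladAdjoint ρ φ χ = 0)
    (D : ℕ → Submodule ℂ 𝓢(Conf N, ℂ)) (hfin : ∀ n, FiniteDimensional ℂ (D n))
    (hH : ∀ n, ∀ φ ∈ D n, S.hamiltonian φ ∈ D n) (hL0 : ∀ φ ∈ D 0, S.lindblad φ = 0)
    (hL : ∀ n, ∀ φ ∈ D (n + 1), S.lindblad φ ∈ D n)
    (hLad : ∀ n, ∀ φ ∈ D n, S.lindbladAdjoint φ ∈ D (n + 1)) (n : ℕ) :
    ∀ φ ∈ D n, ρ (ket (S.lindbladAdjoint φ)) = 0 := by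
  have hsymm : ∀ x y, inner ℂ x (ρ y) = conj (inner ℂ y (ρ x)) := fun x y => by
    rw [inner_conj_symm, hρ.inner_left_eq_inner_right]
  -- tracing the stationarity equation over `D n` removes the Hamiltonian part
  have hstep : ∀ (n k : ℕ) (e : Fin k → 𝓢(Conf N, ℂ)), IsKetBasis (D n) e →
      ∑ i, inner ℂ (ket (S.lindbladAdjoint (e i))) (ρ (ket (S.lindbladAdjoint (e i)))) =
        (1 / 2) * ∑ i, inner ℂ (ket (S.lindbladAdjoint (S.lindblad (e i)))) (ρ (ket (e i))) +
        (1 / 2) * conj (∑ i, inner ℂ (ket (S.lindbladAdjoint (S.lindblad (e i))))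
          (ρ (ket (e i))) : ℂ) := by
    intro n k e he
    have h := Finset.sum_congr rfl fun i (_ : i ∈ Finset.univ) => hform (e i) (e i)
    have hcyc := sum_inner_cyclic (C := LinearMap.id) he he S.inner_hamiltonian (hH n) (hH n) ρ
    simp only [LinearMap.id_apply] at hcyc
    simp only [lindbladForm, Finset.sum_sub_distrib, Finset.sum_add_distrib, ← Finset.mul_sum,
      Finset.sum_const_zero, hcyc, sub_self, mul_zero, zero_add] at h
    rw [map_sum]
    simp only [← hsymm]
    linear_combination h
  -- cyclicity turns the trace of `L* L ρ` over `D (n + 1)` into that of `L ρ L*` over `D n`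
  have htrace : ∀ (n k : ℕ) (e : Fin k → 𝓢(Conf N, ℂ)), IsKetBasis (D n) e →
      ∑ i, inner ℂ (ket (S.lindbladAdjoint (e i))) (ρ (ket (S.lindbladAdjoint (e i)))) =
        (0 : ℂ) := by
    intro n
    induction n with
    | zero =>
      intro k e he
      rw [hstep 0 k e he]
      simp [hL0 _ (he.mem _), ket_zero]
    | succ n ih =>
      intro k e he
      have := hfin n
      obtain ⟨l, f, hf⟩ := exists_isKetBasis (D n)
      rw [hstep (n + 1) k e he,
        sum_inner_cyclic (C := S.lindbladAdjoint) he hf S.inner_lindblad (hL n) (hLad n) ρ,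
        ih l f hf]
      simp
  intro φ hφ
  have := hfin n
  obtain ⟨k, e, he⟩ := exists_isKetBasis (D n)
  have hzero : ∀ i, ρ (ket (S.lindbladAdjoint (e i))) = 0 := by
    intro i
    apply hρ.apply_eq_zero_of_inner_eq_zero
    have h := (Finset.sum_eq_zero_iff_of_nonneg (fun i _ => hρ.inner_nonneg_right _)).1
      (htrace n k e he)
    exact h i (Finset.mem_univ i)
  rw [he.expand φ hφ]
  simp [ket_sum, ket_smul, hzero]

/-- If `ρ L*` vanishes on a dense subspace, then on this subspace the kernel of a stationary `ρ`
is invariant under the Hamiltonian. -/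
theorem apply_hamiltonian_eq_zero {ρ : Hilb N →L[ℂ] Hilb N}
    (hform : ∀ φ χ, lindbladForm S.hamiltonian S.lindblad S.lindbladAdjoint ρ φ χ = 0)
    {D : Set 𝓢(Conf N, ℂ)} (hdense : ∀ v : Hilb N, (∀ φ ∈ D, inner ℂ (ket φ) v = 0) → v = 0)
    (hL : ∀ φ ∈ D, S.lindblad φ ∈ D)
    (hzero : ∀ φ ∈ D, ρ (ket (S.lindbladAdjoint φ)) = 0)
    {χ : 𝓢(Conf N, ℂ)} (hχ : χ ∈ D) (hχ0 : ρ (ket χ) = 0) :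
    ρ (ket (S.hamiltonian χ)) = 0 := by
  refine hdense _ fun φ hφ => ?_
  have h := hform φ χ
  rw [lindbladForm, hχ0, hzero χ hχ, hzero _ (hL χ hχ)] at h
  simpa using h

/-- A density operator vanishing on a complement of `ψ` in a dense subspace is the pure state
`|ψ⟩⟨ψ|`. -/
theorem eq_rankOne_of_apply_eq_zero {ρ : Hilb N →L[ℂ] Hilb N} (hρ : IsDensityOperator ρ)
    {ψ : 𝓢(Conf N, ℂ)} (hψ : ‖ket ψ‖ = 1)
    {D : Set 𝓢(Conf N, ℂ)} (hdense : ∀ v : Hilb N, (∀ φ ∈ D, inner ℂ (ket φ) v = 0) → v = 0)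
    (hdecomp : ∀ φ ∈ D, ∃ (a : ℂ) (χ : 𝓢(Conf N, ℂ)), φ = a • ψ + χ ∧
      inner ℂ (ket ψ) (ket χ) = (0 : ℂ) ∧ ρ (ket χ) = 0) :
    ρ = InnerProductSpace.rankOne ℂ (ket ψ) (ket ψ) := by
  have hnorm : inner ℂ (ket ψ) (ket ψ) = (1 : ℂ) := by
    rw [inner_self_eq_norm_sq_to_K, hψ]; simp
  have hsymm : ∀ x y, inner ℂ x (ρ y) = inner ℂ (ρ x) y := fun x y =>
    (hρ.1.inner_left_eq_inner_right x y).symm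
  set c : ℂ := inner ℂ (ket ψ) (ρ (ket ψ)) with hc
  -- `ρ ψ` is orthogonal to all the `χ`, hence a multiple of `ψ`
  have hψρ : ρ (ket ψ) = c • ket ψ := by
    refine sub_eq_zero.1 (hdense _ fun φ hφ => ?_)
    obtain ⟨a, χ, rfl, h1, h2⟩ := hdecomp φ hφ
    have h3 : inner ℂ (ket χ) (ket ψ) = (0 : ℂ) := by rw [← inner_conj_symm, h1, map_zero]
    rw [ket_add, ket_smul, inner_add_left, inner_smul_left, inner_sub_right, inner_sub_right,
      hsymm (ket χ), h2, inner_smul_right, inner_smul_right, hnorm, h3, ← hc]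
    simp
  have hconj : conj c = c := by
    rw [hc, inner_conj_symm, ← hsymm]
  have hv : ∀ v, ρ v = (c * inner ℂ (ket ψ) v) • ket ψ := by
    intro v
    refine sub_eq_zero.1 (hdense _ fun φ hφ => ?_)
    obtain ⟨a, χ, rfl, h1, h2⟩ := hdecomp φ hφ
    have h3 : inner ℂ (ket χ) (ket ψ) = (0 : ℂ) := by rw [← inner_conj_symm, h1, map_zero]
    rw [inner_sub_right, hsymm, ket_add, ket_smul, map_add, map_smul, h2, hψρ, add_zero,
      inner_smul_left, inner_smul_left, inner_smul_right, inner_add_left, inner_smul_left, hnorm,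
      h3, hconj]
    ring
  -- the trace of `c |ψ⟩⟨ψ|` is `c`
  obtain ⟨w, b, _⟩ := exists_hilbertBasis ℂ (Hilb N)
  have h1 := hρ.2 w b
  have h2 := (b.hasSum_inner_mul_inner (ket ψ) (ket ψ)).mul_left c
  have e : (fun i => inner ℂ (b i) (ρ (b i))) =
      fun i => c * (inner ℂ (ket ψ) (b i) * inner ℂ (b i) (ket ψ)) := by
    funext i
    rw [hv, inner_smul_right]
    ring
  rw [e] at h1
  have hc1 : c = 1 := by
    have := h2.unique h1
    rwa [hnorm, mul_one] at this
  ext1 v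
  rw [hv, hc1, one_mul, InnerProductSpace.rankOne_apply]

end PassiveLocalSystem

/-! ### The Fock filtration of a Gaussian state -/

/-- The annihilation-type operator `p(u) - q(Z u)` attached to the graph matrix `Z`. -/
def annihilator (Z : Matrix (Fin N) (Fin N) ℂ) (u : Fin N → ℂ) : Module.End ℂ 𝓢(Conf N, ℂ) :=
  momLin u - posLin (Z *ᵥ u)

/-- The creation-type operator `p(u) - q(Z̄ u)` attached to the graph matrix `Z`. -/
def creator (Z : Matrix (Fin N) (Fin N) ℂ) (u : Fin N → ℂ) : Module.End ℂ 𝓢(Conf N, ℂ) :=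
  momLin u - posLin (Z.map conj *ᵥ u)

theorem creator_add (Z : Matrix (Fin N) (Fin N) ℂ) (u v : Fin N → ℂ) :
    creator Z (u + v) = creator Z u + creator Z v := by
  simp only [creator, momLin_add, mulVec_add, posLin_add]
  abel

theorem creator_smul (Z : Matrix (Fin N) (Fin N) ℂ) (c : ℂ) (u : Fin N → ℂ) :
    creator Z (c • u) = c • creator Z u := by
  simp only [creator, momLin_smul, mulVec_smul, posLin_smul, smul_sub]

theorem creator_zero (Z : Matrix (Fin N) (Fin N) ℂ) : creator Z 0 = 0 := by
  simp [creator, momLin_zero, posLin_zero]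

/-- The commutator of an annihilator and a creator is a scalar. -/
theorem annihilator_mul_creator (Z : Matrix (Fin N) (Fin N) ℂ) (u v : Fin N → ℂ) :
    ∃ c : ℂ, annihilator Z u * creator Z v = creator Z v * annihilator Z u + c • 1 := by
  refine ⟨Complex.I * (u ⬝ᵥ (Z.map conj *ᵥ v)) - Complex.I * (v ⬝ᵥ (Z *ᵥ u)), ?_⟩
  simp only [annihilator, creator, mul_sub, sub_mul, momLin_mul_posLin, momLin_comm u v,
    posLin_comm (Z *ᵥ u)]
  module

/-- The commutator of a passive Hamiltonian with a creator is a creator, as soon as the Gaussian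
state of graph matrix `Z` is stationary for this Hamiltonian. -/
theorem quadHam_mul_creator {Z R : Matrix (Fin N) (Fin N) ℂ} (hR : R.IsSymm)
    (hRr : R.map conj = R) (hRZ : R + Z * R * Z = 0) (u : Fin N → ℂ) :
    quadHam R * creator Z u = creator Z u * quadHam R +
      Complex.I • creator Z ((R * Z.map conj) *ᵥ u) := by
  have h1 : Z.map conj *ᵥ ((R * Z.map conj) *ᵥ u) = -(R *ᵥ u) := by
    have h2 := congrArg (fun M : Matrix (Fin N) (Fin N) ℂ => M.map (starRingEnd ℂ)) hRZ
    have h3 : R + Z.map conj * R * Z.map conj = 0 := by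
      rw [← (starRingEnd ℂ).mapMatrix_apply] at h2
      simp only [map_add, map_mul, RingHom.mapMatrix_apply, hRr] at h2
      rw [h2]
      ext; simp
    rw [mulVec_mulVec, ← mul_assoc, eq_neg_of_add_eq_zero_right h3, neg_mulVec]
  simp only [creator, mul_sub, sub_mul, quadHam_mul_momLin hR, quadHam_mul_posLin hR, h1,
    mulVec_mulVec, posLin_neg]
  module

/-- The span of the products of at most `n` creators applied to `ψ`. -/
def fock (Z : Matrix (Fin N) (Fin N) ℂ) (ψ : 𝓢(Conf N, ℂ)) : ℕ → Submodule ℂ 𝓢(Conf N, ℂ)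
  | 0 => Submodule.span ℂ {ψ}
  | n + 1 => fock Z ψ n ⊔ ⨆ k, (fock Z ψ n).map (creator Z (Pi.single k 1))

section Fock

variable {Z : Matrix (Fin N) (Fin N) ℂ} {ψ : 𝓢(Conf N, ℂ)}

theorem fock_finiteDimensional (n : ℕ) : FiniteDimensional ℂ (fock Z ψ n) := by
  induction n with
  | zero => exact FiniteDimensional.span_singleton ℂ ψ
  | succ n ih =>
    rw [fock]
    infer_instance

theorem fock_le_succ (n : ℕ) : fock Z ψ n ≤ fock Z ψ (n + 1) := le_sup_left

theorem fock_mono : Monotone (fock Z ψ) := monotone_nat_of_le_succ fock_le_succ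

theorem creator_eq_sum (u : Fin N → ℂ) :
    creator Z u = ∑ k, u k • creator Z (Pi.single k 1) := by
  let f : (Fin N → ℂ) →ₗ[ℂ] Module.End ℂ 𝓢(Conf N, ℂ) :=
    { toFun := creator Z, map_add' := creator_add Z, map_smul' := creator_smul Z }
  exact LinearMap.pi_apply_eq_sum_univ f u |>.trans (by
    refine Finset.sum_congr rfl fun k _ => ?_
    have e : (fun j => if k = j then (1 : ℂ) else 0) = Pi.single k 1 := by
      ext l
      simp [Pi.single_apply, eq_comm]
    rw [e]
    rfl)

theorem creator_mem_fock (u : Fin N → ℂ) {n : ℕ} {φ : 𝓢(Conf N, ℂ)} (hφ : φ ∈ fock Z ψ n) :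
    creator Z u φ ∈ fock Z ψ (n + 1) := by
  rw [creator_eq_sum, LinearMap.sum_apply]
  refine Submodule.sum_mem _ fun k _ => Submodule.smul_mem _ _ ?_
  exact (le_sup_right : _ ≤ fock Z ψ (n + 1))
    ((le_iSup (fun k => (fock Z ψ n).map (creator Z (Pi.single k 1))) k)
      (Submodule.mem_map_of_mem hφ))

/-- Induction along the Fock filtration: a linear condition that holds on `fock Z ψ n` and on the
images of `fock Z ψ n` under the creators holds on `fock Z ψ (n + 1)`. -/
theorem fock_succ_le {n : ℕ} {W : Submodule ℂ 𝓢(Conf N, ℂ)} (h1 : fock Z ψ n ≤ W)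
    (h2 : ∀ u, ∀ φ ∈ fock Z ψ n, creator Z u φ ∈ W) : fock Z ψ (n + 1) ≤ W := by
  refine sup_le h1 (iSup_le fun k => ?_)
  rintro _ ⟨φ, hφ, rfl⟩
  exact h2 _ φ hφ

theorem annihilator_apply_eq_zero (hZ : Z.IsSymm)
    (hψ : ∀ j, momentum j ψ = posLin (Z j) ψ) (u : Fin N → ℂ) : annihilator Z u ψ = 0 := by
  rw [annihilator, LinearMap.sub_apply, momLin_of_nullifier hZ hψ, sub_self]

theorem annihilator_fock_zero (hZ : Z.IsSymm)
    (hψ : ∀ j, momentum j ψ = posLin (Z j) ψ) (u : Fin N → ℂ) :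
    ∀ φ ∈ fock Z ψ 0, annihilator Z u φ = 0 := by
  intro φ hφ
  obtain ⟨c, rfl⟩ := Submodule.mem_span_singleton.1 hφ
  rw [map_smul, annihilator_apply_eq_zero hZ hψ, smul_zero]

theorem annihilator_mem_fock (hZ : Z.IsSymm)
    (hψ : ∀ j, momentum j ψ = posLin (Z j) ψ) (u : Fin N → ℂ) (n : ℕ) :
    ∀ φ ∈ fock Z ψ (n + 1), annihilator Z u φ ∈ fock Z ψ n := by
  have hcr : ∀ (m : ℕ) (W : Submodule ℂ 𝓢(Conf N, ℂ)) (v : Fin N → ℂ), ∀ φ ∈ fock Z ψ m,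
      φ ∈ W → creator Z v (annihilator Z u φ) ∈ W → annihilator Z u (creator Z v φ) ∈ W := by
    intro m W v φ _ h1 h2
    obtain ⟨c, hc⟩ := annihilator_mul_creator Z u v
    have h := congrArg (fun T : Module.End ℂ 𝓢(Conf N, ℂ) => T φ) hc
    simp only [Module.End.mul_apply, LinearMap.add_apply, LinearMap.smul_apply,
      Module.End.one_apply] at h
    rw [h]
    exact W.add_mem h2 (W.smul_mem c h1)
  induction n with
  | zero =>
    refine fock_succ_le (W := (fock Z ψ 0).comap (annihilator Z u)) (fun φ hφ => ?_)
      fun v φ hφ => ?_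
    · rw [Submodule.mem_comap, annihilator_fock_zero hZ hψ u φ hφ]
      exact Submodule.zero_mem _
    · refine hcr 0 _ v φ hφ hφ ?_
      rw [annihilator_fock_zero hZ hψ u φ hφ, map_zero]
      exact Submodule.zero_mem _
  | succ n ih =>
    refine fock_succ_le (W := (fock Z ψ (n + 1)).comap (annihilator Z u)) (fun φ hφ => ?_)
      fun v φ hφ => ?_
    · exact fock_le_succ n (ih φ hφ)
    · exact hcr (n + 1) _ v φ hφ hφ (creator_mem_fock v (ih φ hφ))

theorem quadHam_mem_fock {R : Matrix (Fin N) (Fin N) ℂ} (hR : R.IsSymm)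
    (hRr : R.map conj = R) (hRZ : R + Z * R * Z = 0) {E : ℂ} (hE : quadHam R ψ = E • ψ) (n : ℕ) :
    ∀ φ ∈ fock Z ψ n, quadHam R φ ∈ fock Z ψ n := by
  induction n with
  | zero =>
    intro φ hφ
    obtain ⟨c, rfl⟩ := Submodule.mem_span_singleton.1 hφ
    rw [map_smul, hE]
    exact Submodule.smul_mem _ _ (Submodule.smul_mem _ _ (Submodule.mem_span_singleton_self ψ))
  | succ n ih =>
    refine fock_succ_le (W := (fock Z ψ (n + 1)).comap (quadHam R))
      (fun φ hφ => fock_le_succ n (ih φ hφ)) fun u φ hφ => ?_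
    have h := congrArg (fun T : Module.End ℂ 𝓢(Conf N, ℂ) => T φ)
      (quadHam_mul_creator hR hRr hRZ u)
    simp only [Module.End.mul_apply, LinearMap.add_apply, LinearMap.smul_apply] at h
    rw [Submodule.mem_comap, h]
    exact Submodule.add_mem _ (creator_mem_fock u (ih φ hφ))
      (Submodule.smul_mem _ _ (creator_mem_fock _ hφ))

/-- Position operators raise the Fock filtration by one: they are combinations of creators and
annihilators, because the imaginary part of `Z` is invertible. -/
theorem posLin_mem_fock (hZ : IsGraphMatrix Z)
    (hψ : ∀ j, momentum j ψ = posLin (Z j) ψ) (u : Fin N → ℂ) {n : ℕ} {φ : 𝓢(Conf N, ℂ)}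
    (hφ : φ ∈ fock Z ψ n) : posLin u φ ∈ fock Z ψ (n + 1) := by
  set A := (Z.map Complex.im)⁻¹.map Complex.ofReal with hA
  set Y := (Z.map Complex.im).map Complex.ofReal with hY
  have hYA : Y * A = 1 := by
    have h := congrArg Complex.ofRealHom.mapMatrix
      (mul_nonsing_inv _ hZ.2.det_pos.ne'.isUnit)
    rwa [map_mul, map_one] at h
  set w : Fin N → ℂ := (2 * Complex.I)⁻¹ • (A *ᵥ u) with hw
  have hdiff : Z - Z.map conj = (2 * Complex.I) • Y := by
    rw [← matrix_re_sub_im, ← hY]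
    nth_rewrite 1 [← matrix_re_add_im Z]
    rw [← hY]
    module
  -- the momentum parts cancel, and `(Z - Z̄) w = 2 i Y w = u`
  have e : posLin u = creator Z w - annihilator Z w := by
    have h1 : (Z - Z.map conj) *ᵥ w = u := by
      rw [hdiff, hw, smul_mulVec, mulVec_smul, smul_smul, mulVec_mulVec, hYA, one_mulVec,
        mul_inv_cancel₀ (by simp), one_smul]
    rw [creator, annihilator, sub_sub_sub_cancel_left, ← posLin_sub, ← sub_mulVec, h1]
  rw [e, LinearMap.sub_apply]
  refine Submodule.sub_mem _ (creator_mem_fock w hφ) ?_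
  exact fock_mono (by omega) (annihilator_mem_fock hZ.1 hψ w n φ (fock_le_succ n hφ))

theorem inner_creator (hZ : Z.IsSymm) (hψ : ∀ j, momentum j ψ = posLin (Z j) ψ) (u : Fin N → ℂ)
    (φ : 𝓢(Conf N, ℂ)) : inner ℂ (ket ψ) (ket (creator Z u φ)) = (0 : ℂ) := by
  have h := annihilator_apply_eq_zero hZ hψ (star u)
  have h1 : inner ℂ (ket (annihilator Z (star u) ψ)) (ket φ) =
      inner ℂ (ket ψ) (ket (creator Z u φ)) := by
    have e : star (Z *ᵥ star u) = Z.map conj *ᵥ u := by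
      ext j
      simp [mulVec, dotProduct]
    rw [annihilator, creator, LinearMap.sub_apply, LinearMap.sub_apply, ket_sub, ket_sub,
      inner_sub_left, inner_sub_right, inner_momLin, inner_posLin, star_star, e]
  rw [← h1, h, ket_zero, inner_zero_left]

end Fock

/-! ### Uniqueness and non-uniqueness of Gaussian steady states -/

/-- The subspace of the `u` such that `ρ` vanishes on the image of the creator of `u`. -/
def killedCreators (Z : Matrix (Fin N) (Fin N) ℂ) (ψ : 𝓢(Conf N, ℂ)) (ρ : Hilb N →L[ℂ] Hilb N) :
    Submodule ℂ (Fin N → ℂ) where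
  carrier := {u | ∀ n, ∀ φ ∈ fock Z ψ n, ρ (ket (creator Z u φ)) = 0}
  zero_mem' := fun n φ _ => by simp [creator_zero, ket_zero]
  add_mem' := fun {u v} hu hv n φ hφ => by
    rw [creator_add, LinearMap.add_apply, ket_add, map_add, hu n φ hφ, hv n φ hφ, add_zero]
  smul_mem' := fun c u hu n φ hφ => by
    rw [creator_smul, LinearMap.smul_apply, ket_smul, map_smul, hu n φ hφ, smul_zero]

namespace PassiveLocalSystem

variable (S : PassiveLocalSystem N)

/-- The matrix `R` of the Hamiltonian with complex entries. -/
def couplingMatrixC : Matrix (Fin N) (Fin N) ℂ := S.couplingMatrix.map Complex.ofReal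

theorem couplingMatrixC_isSymm : S.couplingMatrixC.IsSymm := by
  ext j k
  simp [couplingMatrixC, S.couplingMatrix_isSymm.apply]

theorem couplingMatrixC_map_conj : S.couplingMatrixC.map conj = S.couplingMatrixC := by
  ext j k
  simp [couplingMatrixC]

theorem hamiltonian_eq_quadHam : S.hamiltonian = quadHam S.couplingMatrixC := S.hamiltonian_eq

theorem lindblad_eq_linear :
    S.lindblad = posLin (Pi.single S.site S.c₁) + momLin (Pi.single S.site S.c₂) := by
  have h : ∀ c : ℂ, Pi.single S.site c = c • (Pi.single S.site 1 : Fin N → ℂ) := fun c => by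
    rw [← Pi.single_smul, smul_eq_mul, mul_one]
  rw [h S.c₁, h S.c₂, posLin_smul, momLin_smul, posLin_single, momLin_single]
  rfl

theorem lindbladAdjoint_eq_linear :
    S.lindbladAdjoint =
      posLin (Pi.single S.site (conj S.c₁)) + momLin (Pi.single S.site (conj S.c₂)) := by
  have h : ∀ c : ℂ, Pi.single S.site c = c • (Pi.single S.site 1 : Fin N → ℂ) := fun c => by
    rw [← Pi.single_smul, smul_eq_mul, mul_one]
  rw [h (conj S.c₁), h (conj S.c₂), posLin_smul, momLin_smul, posLin_single, momLin_single]
  rfl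

theorem lindblad_eq_annihilator {Z : Matrix (Fin N) (Fin N) ℂ}
    (hL : Pi.single S.site S.c₁ + Z *ᵥ Pi.single S.site S.c₂ = 0) :
    S.lindblad = annihilator Z (Pi.single S.site S.c₂) := by
  rw [lindblad_eq_linear, annihilator, eq_neg_of_add_eq_zero_left hL, posLin_neg]
  abel

theorem lindbladAdjoint_eq_creator {Z : Matrix (Fin N) (Fin N) ℂ}
    (hL : Pi.single S.site S.c₁ + Z *ᵥ Pi.single S.site S.c₂ = 0) :
    S.lindbladAdjoint = creator Z (Pi.single S.site (conj S.c₂)) := by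
  have h : Pi.single S.site (conj S.c₁) = -(Z.map conj *ᵥ Pi.single S.site (conj S.c₂)) := by
    have h1 := eq_neg_of_add_eq_zero_left hL
    ext j
    have h2 := congrArg conj (congrFun h1 j)
    rw [mulVec_single] at h2 ⊢
    simp only [Pi.neg_apply, Pi.smul_apply, MulOpposite.smul_eq_mul_unop, MulOpposite.unop_op,
      col_apply, map_neg, map_mul, map_apply] at h2 ⊢
    rw [← h2]
    by_cases hj : j = S.site
    · subst hj; simp
    · simp [hj]
  rw [lindbladAdjoint_eq_linear, creator, h, posLin_neg]
  abel

/-- A Gaussian pure state of graph matrix `Z` is the unique steady state if it is stationary and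
the creation operators generated from `L*` by commutators with `H` span all creation operators. -/
theorem isUniqueSteadyState_of_cyclic {Z : Matrix (Fin N) (Fin N) ℂ} (hZ : IsGraphMatrix Z)
    {ψ : 𝓢(Conf N, ℂ)} (hwave : IsGaussianWave ψ) (hnorm : ‖ket ψ‖ = 1)
    (hψ : ∀ j, momentum j ψ = posLin (Z j) ψ)
    (hL : Pi.single S.site S.c₁ + Z *ᵥ Pi.single S.site S.c₂ = 0)
    (hRZ : S.couplingMatrixC + Z * S.couplingMatrixC * Z = 0)
    (hcyc : ∀ U : Submodule ℂ (Fin N → ℂ), Pi.single S.site (conj S.c₂) ∈ U →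
      (∀ u ∈ U, (S.couplingMatrixC * Z.map conj) *ᵥ u ∈ U) → U = ⊤) :
    S.IsUniqueSteadyState (InnerProductSpace.rankOne ℂ (ket ψ) (ket ψ)) := by
  have hLψ : S.lindblad ψ = 0 := by
    rw [S.lindblad_eq_annihilator hL, annihilator_apply_eq_zero hZ.1 hψ]
  have hHψ : S.hamiltonian ψ = (-(Complex.I / 2) * (Z * S.couplingMatrixC).trace) • ψ := by
    ext x
    rw [hamiltonian_eq_quadHam, quadHam_apply_of_nullifier hZ.1 S.couplingMatrixC_isSymm hψ, hRZ]
    simp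
  refine ⟨S.isSteadyState_rankOne hnorm hLψ hHψ, fun ρ hρ => ?_⟩
  have hform := solvesMasterEquation_const_iff.1 hρ.2
  set D : Set 𝓢(Conf N, ℂ) := {φ | ∃ n, φ ∈ fock Z ψ n} with hD
  obtain ⟨c, hc⟩ := wave_eq_of_nullifier hwave hψ
  have hdense : ∀ v : Hilb N, (∀ φ ∈ D, inner ℂ (ket φ) v = 0) → v = 0 := by
    intro v hv
    refine eq_zero_of_orthogonal (ψ := ψ) (fun x => ?_) (memLp_exp_mul_wave hZ hc)
      (D := D) ⟨0, Submodule.mem_span_singleton_self ψ⟩ ?_ hv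
    · rw [hc]; exact Complex.exp_ne_zero _
    · rintro u φ ⟨n, hφ⟩
      exact ⟨n + 1, posLin_mem_fock hZ hψ u hφ⟩
  have hH : ∀ n, ∀ φ ∈ fock Z ψ n, S.hamiltonian φ ∈ fock Z ψ n := by
    rw [hamiltonian_eq_quadHam] at hHψ ⊢
    exact quadHam_mem_fock S.couplingMatrixC_isSymm S.couplingMatrixC_map_conj hRZ hHψ
  have hLD : ∀ n, ∀ φ ∈ fock Z ψ (n + 1), S.lindblad φ ∈ fock Z ψ n := by
    rw [S.lindblad_eq_annihilator hL]
    exact annihilator_mem_fock hZ.1 hψ _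
  have hLad : ∀ n, ∀ φ ∈ fock Z ψ n, ρ (ket (S.lindbladAdjoint φ)) = 0 := by
    refine fun n => S.apply_lindbladAdjoint_eq_zero hρ.1.1 hform (fock Z ψ)
      fock_finiteDimensional hH ?_ hLD ?_ n
    · rw [S.lindblad_eq_annihilator hL]
      exact annihilator_fock_zero hZ.1 hψ _
    · rw [S.lindbladAdjoint_eq_creator hL]
      exact fun n φ hφ => creator_mem_fock _ hφ
  have hHD : ∀ χ ∈ D, ρ (ket χ) = 0 → ρ (ket (S.hamiltonian χ)) = 0 := by
    refine fun χ hχ h0 => S.apply_hamiltonian_eq_zero hform hdense ?_ ?_ hχ h0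
    · rintro φ ⟨n, hφ⟩
      exact ⟨n, hLD n φ (fock_le_succ n hφ)⟩
    · rintro φ ⟨n, hφ⟩
      exact hLad n φ hφ
  -- `killedCreators` contains the direction of `L*` and is invariant under commutators with `H`
  have htop : killedCreators Z ψ ρ = ⊤ := by
    refine hcyc _ ?_ fun u hu n φ hφ => ?_
    · intro n φ hφ
      rw [← S.lindbladAdjoint_eq_creator hL]
      exact hLad n φ hφ
    · have h := congrArg (fun T : Module.End ℂ 𝓢(Conf N, ℂ) => T φ)
        (quadHam_mul_creator S.couplingMatrixC_isSymm S.couplingMatrixC_map_conj hRZ u)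
      simp only [Module.End.mul_apply, LinearMap.add_apply, LinearMap.smul_apply] at h
      rw [← hamiltonian_eq_quadHam] at h
      have h1 := hHD _ ⟨n + 1, creator_mem_fock u hφ⟩ (hu n φ hφ)
      rw [h, ket_add, map_add, hu n _ (hH n φ hφ), zero_add, ket_smul, map_smul] at h1
      exact (smul_eq_zero.1 h1).resolve_left Complex.I_ne_zero
  refine eq_rankOne_of_apply_eq_zero hρ.1 hnorm hdense ?_
  -- everything above the bottom level is in the image of creators: orthogonal to `ψ`, killed by `ρ`
  have hdec : ∀ n, fock Z ψ n ≤ Submodule.span ℂ {ψ} ⊔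
      ((Submodule.span ℂ {ket ψ})ᗮ ⊓ (ρ : Hilb N →ₗ[ℂ] Hilb N).ker).comap ketₗ := by
    intro n
    induction n with
    | zero => exact le_sup_left
    | succ n ih =>
      refine fock_succ_le ih fun u φ hφ => Submodule.mem_sup_right ⟨?_, ?_⟩
      · exact Submodule.mem_orthogonal_singleton_iff_inner_right.2 (inner_creator hZ.1 hψ u φ)
      · have hu : u ∈ killedCreators Z ψ ρ := htop ▸ Submodule.mem_top
        exact hu n φ hφ
  rintro φ ⟨n, hφ⟩
  obtain ⟨y, hy, χ, ⟨h1, h2⟩, rfl⟩ := Submodule.mem_sup.1 (hdec n hφ)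
  obtain ⟨a, rfl⟩ := Submodule.mem_span_singleton.1 hy
  exact ⟨a, χ, rfl, Submodule.mem_orthogonal_singleton_iff_inner_right.1 h1, h2⟩

/-- A stationary Gaussian pure state is not the unique steady state if some nonzero subspace of
directions `u` is invariant under `Z R` and decoupled from the Lindblad operator: for an eigenvector
`u` of `Z R` in this subspace, the normalization of `q(u) ψ` is stationary as well. -/
theorem not_isUniqueSteadyState {Z : Matrix (Fin N) (Fin N) ℂ} (hZ : Z.IsSymm)
    {ψ : 𝓢(Conf N, ℂ)} (hψ0 : ∀ x, ψ x ≠ 0)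
    (hmean : ∀ j, inner ℂ (ket ψ) (ket (position j ψ)) = (0 : ℂ))
    (hψ : ∀ j, momentum j ψ = posLin (Z j) ψ)
    (hL : S.lindblad ψ = 0) {E : ℂ} (hE : S.hamiltonian ψ = E • ψ)
    {K : Submodule ℂ (Fin N → ℂ)} (hK : K ≠ ⊥) (hinv : ∀ u ∈ K, (Z * S.couplingMatrixC) *ᵥ u ∈ K)
    (hsite : ∀ u ∈ K, S.c₂ * u S.site = 0) :
    ¬ S.IsUniqueSteadyState (InnerProductSpace.rankOne ℂ (ket ψ) (ket ψ)) := by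
  intro huniq
  have : Nontrivial K := Submodule.nontrivial_iff_ne_bot.2 hK
  obtain ⟨μ, hμ⟩ := Module.End.exists_eigenvalue
    ((Matrix.toLin' (Z * S.couplingMatrixC)).restrict (p := K) (q := K)
      (fun u hu => by simpa using hinv u hu))
  obtain ⟨⟨u, huK⟩, hu, hu0⟩ := hμ.exists_hasEigenvector
  have hμu : (Z * S.couplingMatrixC) *ᵥ u = μ • u := by
    have h := congrArg Subtype.val (Module.End.mem_eigenspace_iff.1 hu)
    simpa using h
  have hune : u ≠ 0 := fun h => hu0 (Subtype.ext h)
  set χ := posLin u ψ with hχ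
  have hχ0 : χ ≠ 0 := by
    intro h0
    apply hune
    ext k
    have h := congrArg (fun φ : 𝓢(Conf N, ℂ) => φ (EuclideanSpace.single k 1)) h0
    simpa [hχ, posLin_apply_cvec, cvec_single, hψ0] using h
  -- `L` commutes with `q(u)`, their commutator being a multiple of `c₂ u_l`
  have hLχ : S.lindblad χ = 0 := by
    have h1 : S.lindblad * posLin u = posLin u * S.lindblad := by
      rw [lindblad_eq_linear, add_mul, mul_add, momLin_mul_posLin, posLin_comm, single_dotProduct,
        hsite u huK]
      simp
    have h2 := congrArg (fun T : Module.End ℂ 𝓢(Conf N, ℂ) => T ψ) h1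
    simpa [Module.End.mul_apply, hL] using h2
  -- `[H, q(u)] ψ = -i p(R u) ψ = -i q(Z R u) ψ`
  have hHχ : S.hamiltonian χ = (E - Complex.I * μ) • χ := by
    have h2 := congrArg (fun T : Module.End ℂ 𝓢(Conf N, ℂ) => T ψ)
      (quadHam_mul_posLin S.couplingMatrixC_isSymm u)
    simp only [Module.End.mul_apply, LinearMap.sub_apply, LinearMap.smul_apply] at h2
    rw [← hamiltonian_eq_quadHam, hE, map_smul, momLin_of_nullifier hZ hψ, mulVec_mulVec, hμu,
      posLin_smul, LinearMap.smul_apply] at h2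
    rw [hχ, h2, sub_smul, mul_smul]
  have hkχ : ket χ ≠ 0 := fun h => hχ0 (ket_eq_zero h)
  set ω : 𝓢(Conf N, ℂ) := ((‖ket χ‖⁻¹ : ℝ) : ℂ) • χ with hω
  have hωn : ‖ket ω‖ = 1 := by
    rw [hω, ket_smul, norm_smul, Complex.norm_real, norm_inv, norm_norm,
      inv_mul_cancel₀ (norm_ne_zero_iff.2 hkχ)]
  have hsteady := S.isSteadyState_rankOne hωn (by rw [hω, map_smul, hLχ, smul_zero])
    (E := E - Complex.I * μ) (by rw [hω, map_smul, hHχ, smul_comm])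
  have heq := huniq.2 _ hsteady
  -- the new state is orthogonal to `ψ`, because the means of `ψ` vanish
  have horth : inner ℂ (ket ψ) (ket ω) = (0 : ℂ) := by
    rw [hω, ket_smul, inner_smul_right, hχ, inner_posLin_right]
    simp [hmean]
  have h1 := congrArg (fun T : Hilb N →L[ℂ] Hilb N => T (ket ω)) heq
  simp only [InnerProductSpace.rankOne_apply, horth, zero_smul] at h1
  rw [inner_self_eq_norm_sq_to_K, hωn] at h1
  simp only [RCLike.ofReal_one, one_pow, one_smul] at h1
  rw [h1, norm_zero] at hωn
  exact zero_ne_one hωn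

/-- Stationarity of the Gaussian pure state of graph matrix `Z`, in terms of `Z`. -/
theorem algebraic_of_stationary {Z : Matrix (Fin N) (Fin N) ℂ} (hZ : Z.IsSymm)
    {ψ : 𝓢(Conf N, ℂ)} (hψ0 : ∀ x, ψ x ≠ 0) (hψ : ∀ j, momentum j ψ = posLin (Z j) ψ)
    (hL : S.lindblad ψ = 0) {E : ℂ} (hE : S.hamiltonian ψ = E • ψ) :
    Pi.single S.site S.c₁ + Z *ᵥ Pi.single S.site S.c₂ = 0 ∧
      S.couplingMatrixC + Z * S.couplingMatrixC * Z = 0 := by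
  constructor
  · rw [lindblad_eq_linear, LinearMap.add_apply, momLin_of_nullifier hZ hψ,
      ← LinearMap.add_apply, ← posLin_add] at hL
    ext k
    have h := congrArg (fun φ : 𝓢(Conf N, ℂ) => φ (EuclideanSpace.single k 1)) hL
    rw [Pi.zero_apply]
    simpa only [posLin_apply_cvec, cvec_single, dotProduct_single, mul_one, _root_.zero_apply,
      mul_eq_zero, hψ0, or_false] using h
  · have hval : ∀ x : Conf N,
        (1 / 2) * (cvec x ⬝ᵥ ((S.couplingMatrixC + Z * S.couplingMatrixC * Z) *ᵥ cvec x))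
        - (Complex.I / 2) * (Z * S.couplingMatrixC).trace = E := by
      intro x
      have h := congrArg (fun φ : 𝓢(Conf N, ℂ) => φ x) hE
      simp only [hamiltonian_eq_quadHam,
        quadHam_apply_of_nullifier hZ S.couplingMatrixC_isSymm hψ] at h
      exact mul_right_cancel₀ (hψ0 x) h
    refine eq_zero_of_quadForm ?_ fun x => ?_
    · have hs := S.couplingMatrixC_isSymm
      rw [IsSymm, transpose_add, transpose_mul, transpose_mul, hZ.eq, hs.eq, mul_assoc]
    · have h0 := hval 0
      have hc0 : cvec (0 : Conf N) = 0 := by ext k; simp [cvec]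
      rw [hc0, zero_dotProduct] at h0
      linear_combination 2 * hval x - 2 * h0

end PassiveLocalSystem

/-! ### Alternating eigenbases of graph matrices -/

/-- The sequence `z, -1/z, z, -1/z, …`. -/
def altDiag (N : ℕ) (z : ℂ) (k : Fin N) : ℂ := if Even (k : ℕ) then z else -1 / z

theorem altDiag_ne_zero {z : ℂ} (hz : z ≠ 0) (k : Fin N) : altDiag N z k ≠ 0 := by
  unfold altDiag
  split_ifs
  · exact hz
  · exact div_ne_zero (by simp) hz

theorem altDiag_mul_altDiag {z : ℂ} (hz : z ≠ 0) {j k : Fin N} (h : (j : ℕ) + 1 = k) :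
    altDiag N z j * altDiag N z k = -1 := by
  unfold altDiag
  rw [← h]
  by_cases hj : Even (j : ℕ) <;> simp [hj, Nat.even_add_one] <;> field_simp

/-- `Z` has a real orthonormal eigenbasis, given by the rows of an orthogonal matrix `W`, that
starts with the `l`th coordinate vector and has the eigenvalues `z, -1/z, z, …`. -/
def HasAlternatingEigenbasis (Z : Matrix (Fin N) (Fin N) ℂ) (z : ℂ) (l : Fin N) : Prop :=
  ∃ W ∈ orthogonalGroup (Fin N) ℝ, (∀ k : Fin N, (k : ℕ) = 0 → W k = Pi.single l 1) ∧
    Z = (W.map Complex.ofReal)ᵀ * diagonal (altDiag N z) * W.map Complex.ofReal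

theorem map_ofReal_mul {m n o : Type*} [Fintype n] (A : Matrix m n ℝ) (B : Matrix n o ℝ) :
    (A * B).map Complex.ofReal = A.map Complex.ofReal * B.map Complex.ofReal :=
  Matrix.map_mul (f := Complex.ofRealHom)

theorem map_ofReal_mulVec {m n : Type*} [Fintype n] (A : Matrix m n ℝ) (u : n → ℝ) :
    A.map Complex.ofReal *ᵥ (fun i => (u i : ℂ)) = fun i => (((A *ᵥ u) i : ℝ) : ℂ) := by
  ext i
  simp [mulVec, dotProduct]

theorem map_ofReal_one {n : Type*} [DecidableEq n] :
    (1 : Matrix n n ℝ).map Complex.ofReal = 1 :=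
  Matrix.map_one _ Complex.ofReal_zero Complex.ofReal_one

theorem map_ofReal_orthogonal {n : Type*} [Fintype n] [DecidableEq n] {W : Matrix n n ℝ}
    (hW : W ∈ orthogonalGroup n ℝ) :
    (W.map Complex.ofReal)ᵀ * W.map Complex.ofReal = 1 ∧
      W.map Complex.ofReal * (W.map Complex.ofReal)ᵀ = 1 := by
  have h1 : Wᵀ * W = 1 := (mem_orthogonalGroup_iff' _ _).1 hW
  have h2 : W * Wᵀ = 1 := (mem_orthogonalGroup_iff _ _).1 hW
  rw [← transpose_map, ← map_ofReal_mul, ← map_ofReal_mul, h1, h2, map_ofReal_one]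
  exact ⟨rfl, rfl⟩

/-- The adjacency matrix of the path with vertices `0, 1, …, N - 1`. -/
def pathMatrix (N : ℕ) : Matrix (Fin N) (Fin N) ℝ :=
  Matrix.of fun j k => if (j : ℕ) + 1 = k ∨ (k : ℕ) + 1 = j then 1 else 0

theorem pathMatrix_isSymm : (pathMatrix N).IsSymm := by
  ext j k
  simp [pathMatrix, or_comm]

theorem pathMatrix_add_altDiag {z : ℂ} (hz : z ≠ 0) :
    (pathMatrix N).map Complex.ofReal +
      diagonal (altDiag N z) * (pathMatrix N).map Complex.ofReal * diagonal (altDiag N z) = 0 := by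
  ext j k
  rw [Matrix.add_apply, mul_diagonal, diagonal_mul]
  simp only [pathMatrix, map_apply, of_apply, Matrix.zero_apply]
  split_ifs with h
  · have h1 : altDiag N z j * altDiag N z k = -1 := by
      rcases h with h | h
      · exact altDiag_mul_altDiag hz h
      · rw [mul_comm]; exact altDiag_mul_altDiag hz h
    simp only [Complex.ofReal_one, mul_one, h1, add_neg_cancel]
  · simp

theorem mulVec_eq_sum_smul_single (M : Matrix (Fin N) (Fin N) ℂ) (c : Fin N → ℂ) :
    M *ᵥ c = ∑ i, c i • (M *ᵥ Pi.single i 1) := by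
  ext j
  simp [mulVec, dotProduct, Finset.sum_apply, mul_comm]

/-- A subspace of `ℂ^N` containing the first vector `Wᵀ e₀` of a basis and stable under
`Wᵀ J D W`, with `J` the adjacency matrix of a path and `D` an invertible diagonal matrix, is the
whole space: step by step it contains all the vectors `Wᵀ e_k`. -/
theorem eq_top_of_path_invariant {W : Matrix (Fin N) (Fin N) ℂ} (hW : Wᵀ * W = 1)
    (hW' : W * Wᵀ = 1) {d : Fin N → ℂ} (hd : ∀ k, d k ≠ 0) {U : Submodule ℂ (Fin N → ℂ)}
    (h0 : ∀ k : Fin N, (k : ℕ) = 0 → Wᵀ *ᵥ Pi.single k 1 ∈ U)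
    (hU : ∀ u ∈ U,
      (Wᵀ * (pathMatrix N).map Complex.ofReal * diagonal d * W) *ᵥ u ∈ U) : U = ⊤ := by
  have hmem : ∀ (n : ℕ) (hn : n < N), Wᵀ *ᵥ Pi.single ⟨n, hn⟩ 1 ∈ U := by
    intro n
    induction n using Nat.strong_induction_on with
    | _ n ih =>
      intro hn
      rcases n with - | n
      · exact h0 _ rfl
      · have hn' : n < N := by omega
        have h1 := hU _ (ih n (by omega) hn')
        rw [mulVec_mulVec, mul_assoc, hW', mul_one, ← mulVec_mulVec, ← mulVec_mulVec,
          diagonal_mulVec_single, mul_one] at h1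
        have e1 : Pi.single (⟨n, hn'⟩ : Fin N) (d ⟨n, hn'⟩) =
            d ⟨n, hn'⟩ • (Pi.single ⟨n, hn'⟩ 1 : Fin N → ℂ) := by
          rw [← Pi.single_smul, smul_eq_mul, mul_one]
        rw [e1, mulVec_smul, mulVec_smul] at h1
        have h2 := (Submodule.smul_mem_iff _ (hd _)).1 h1
        -- `J e_n = e_{n+1} + e_{n-1}`, where the second term `c` is absent for `n = 0`
        set c : Fin N → ℂ := fun i => if (i : ℕ) + 1 = n then 1 else 0 with hc
        have e2 : (pathMatrix N).map Complex.ofReal *ᵥ Pi.single (⟨n, hn'⟩ : Fin N) 1 =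
            Pi.single ⟨n + 1, hn⟩ 1 + c := by
          ext i
          rw [mulVec_single_one, col_apply, Pi.add_apply, map_apply, pathMatrix, of_apply]
          by_cases hi : (i : ℕ) = n + 1
          · have : i = ⟨n + 1, hn⟩ := Fin.ext hi
            subst this
            have h3 : ¬ n + 1 + 1 = n := by omega
            simp [hc, h3]
          · have : i ≠ ⟨n + 1, hn⟩ := fun h => hi (congrArg Fin.val h)
            have h3 : ¬ n + 1 = (i : ℕ) := fun h => hi h.symm
            simp only [h3, or_false, Pi.single_apply, this, if_false, zero_add, hc]
            split_ifs <;> simp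
        rw [e2, mulVec_add] at h2
        refine (Submodule.add_mem_iff_left _ ?_).1 h2
        have e3 : Wᵀ *ᵥ c = ∑ i, c i • (Wᵀ *ᵥ Pi.single i 1) :=
          mulVec_eq_sum_smul_single _ _
        rw [e3]
        refine Submodule.sum_mem _ fun i _ => ?_
        by_cases hi : (i : ℕ) + 1 = n
        · exact Submodule.smul_mem _ _ (ih i (by omega) i.2)
        · simp [hc, hi]
  rw [Submodule.eq_top_iff']
  intro u
  have e : u = ∑ i, (W *ᵥ u) i • (Wᵀ *ᵥ Pi.single i 1) := by
    calc u = Wᵀ *ᵥ (W *ᵥ u) := by rw [mulVec_mulVec, hW, one_mulVec]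
      _ = _ := mulVec_eq_sum_smul_single _ _
  rw [e]
  exact Submodule.sum_mem _ fun i _ => Submodule.smul_mem _ _ (hmem i i.2)

/-- The vectors `R^k e_l` are eigenvectors of `Z`, for the eigenvalues `z` and `-1/z`. -/
theorem mulVec_pow_eigen {Z R : Matrix (Fin N) (Fin N) ℂ} (hRZ : R + Z * R * Z = 0) {z : ℂ}
    (hz : z ≠ 0) {e : Fin N → ℂ} (he : Z *ᵥ e = z • e) (k : ℕ) :
    Z *ᵥ (R ^ k *ᵥ e) = (if Even k then z else -1 / z) • (R ^ k *ᵥ e) := by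
  induction k with
  | zero => simp [he]
  | succ k ih =>
    set c : ℂ := if Even k then z else -1 / z with hc
    have hc0 : c ≠ 0 := by
      rw [hc]; split_ifs
      · exact hz
      · exact div_ne_zero (by simp) hz
    have h1 : Z *ᵥ (R *ᵥ (Z *ᵥ (R ^ k *ᵥ e))) = -(R *ᵥ (R ^ k *ᵥ e)) := by
      rw [mulVec_mulVec, mulVec_mulVec, eq_neg_of_add_eq_zero_right hRZ, neg_mulVec]
    rw [ih, mulVec_smul, mulVec_smul] at h1
    have h2 : (if Even (k + 1) then z else -1 / z) = -c⁻¹ := by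
      by_cases hk : Even k
      · simp [hc, hk, Nat.even_add_one, neg_div]
      · simp [hc, hk, Nat.even_add_one, neg_div]
    rw [pow_succ', ← mulVec_mulVec, h2, neg_smul, ← smul_neg, ← h1, smul_smul, inv_mul_cancel₀ hc0,
      one_smul]

/-- Cayley–Hamilton: a vector orthogonal to `R^k e` for `k < N` is orthogonal to all `R^k e`. -/
theorem dotProduct_pow_eq_zero {R : Matrix (Fin N) (Fin N) ℝ} {e u : Fin N → ℝ}
    (h : ∀ k < N, u ⬝ᵥ (R ^ k *ᵥ e) = 0) (k : ℕ) : u ⬝ᵥ (R ^ k *ᵥ e) = 0 := by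
  rcases Nat.eq_zero_or_pos N with hN | hN
  · subst hN
    simp [dotProduct]
  rw [pow_eq_aeval_mod_charpoly, Polynomial.aeval_eq_sum_range' (n := N)]
  · rw [sum_mulVec, dotProduct_sum]
    refine Finset.sum_eq_zero fun j hj => ?_
    rw [smul_mulVec, dotProduct_smul, h j (Finset.mem_range.1 hj), smul_zero]
  · have hdeg : R.charpoly.natDegree = N := by simp
    have : R.charpoly ≠ 1 := by
      intro h1
      rw [h1, Polynomial.natDegree_one] at hdeg
      omega
    have h2 := Polynomial.natDegree_modByMonic_lt (Polynomial.X ^ k) R.charpoly_monic this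
    omega

/-- Gram–Schmidt orthonormalization of a cyclic family `R^k e_l` of eigenvectors of `Z` gives an
alternating eigenbasis: eigenvectors for different eigenvalues of the symmetric matrix `Z` being
orthogonal, each step only involves vectors with the same eigenvalue. -/
theorem hasAlternatingEigenbasis_of_cyclic {Z : Matrix (Fin N) (Fin N) ℂ} (hZ : Z.IsSymm)
    {R : Matrix (Fin N) (Fin N) ℝ}
    (hRZ : R.map Complex.ofReal + Z * R.map Complex.ofReal * Z = 0) {z : ℂ} (hz : z ≠ 0)
    {l : Fin N} (he : Z *ᵥ Pi.single l 1 = z • Pi.single l 1)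
    (hcyc : ∀ u : Fin N → ℝ, (∀ k, u ⬝ᵥ (R ^ k *ᵥ Pi.single l 1) = 0) → u = 0) :
    HasAlternatingEigenbasis Z z l := by
  set v : Fin N → Conf N := fun k => WithLp.toLp 2 (R ^ (k : ℕ) *ᵥ Pi.single l 1) with hv
  have hpow : ∀ k : ℕ, (R ^ k).map Complex.ofReal = (R.map Complex.ofReal) ^ k := fun k =>
    map_pow Complex.ofRealHom.mapMatrix R k
  have hsingle : (fun i => (((Pi.single l 1 : Fin N → ℝ) i : ℝ) : ℂ)) = Pi.single l 1 := by
    ext i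
    by_cases hi : i = l <;> simp [hi]
  have hveig : ∀ k, Z *ᵥ cvec (v k) = altDiag N z k • cvec (v k) := by
    intro k
    have e : cvec (v k) = (R.map Complex.ofReal) ^ (k : ℕ) *ᵥ Pi.single l 1 := by
      rw [← hpow, ← hsingle, map_ofReal_mulVec]
      rfl
    rw [e]
    exact mulVec_pow_eigen hRZ hz he k
  have hli : LinearIndependent ℝ v := by
    refine linearIndependent_of_top_le_span_of_card_eq_finrank ?_ (by simp)
    rw [top_le_iff, ← Submodule.orthogonal_eq_bot_iff, Submodule.eq_bot_iff]
    intro u hu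
    have h1 : ∀ k < N, u.ofLp ⬝ᵥ (R ^ k *ᵥ Pi.single l 1) = 0 := by
      intro k hk
      have h2 := (Submodule.mem_orthogonal _ _).1 hu (v ⟨k, hk⟩)
        (Submodule.subset_span ⟨_, rfl⟩)
      simpa [hv, PiLp.inner_apply, dotProduct] using h2
    have h2 := hcyc u.ofLp (dotProduct_pow_eq_zero h1)
    ext i
    exact congrFun h2 i
  have hgs : ∀ k, Z *ᵥ cvec (InnerProductSpace.gramSchmidt ℝ v k) =
      altDiag N z k • cvec (InnerProductSpace.gramSchmidt ℝ v k) := by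
    intro k
    induction k using WellFoundedLT.induction with
    | _ k ih =>
      have hlin : ∀ (a : Conf N) (s : Finset (Fin N)) (b : Fin N → Conf N),
          cvec (a - ∑ i ∈ s, b i) = cvec a - ∑ i ∈ s, cvec (b i) := by
        intro a s b
        ext j
        simp [cvec, Finset.sum_apply]
      rw [InnerProductSpace.gramSchmidt_def, hlin, mulVec_sub, hveig, mulVec_sum, smul_sub,
        Finset.smul_sum]
      congr 1
      refine Finset.sum_congr rfl fun i hi => ?_
      have hik : i < k := Finset.mem_Iio.1 hi
      rw [Submodule.starProjection_singleton]
      set g := InnerProductSpace.gramSchmidt ℝ v i with hg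
      have hsm : ∀ a : ℝ, cvec (a • g) = (a : ℂ) • cvec g := by
        intro a; ext j; simp [cvec]
      rw [hsm, mulVec_smul, ih i hik, smul_comm (altDiag N z k)]
      -- projections onto vectors with the same eigenvalue are harmless, the others vanish; for
      -- `z = i` both eigenvalues coincide and no projection is known to vanish
      by_cases hd : altDiag N z i = altDiag N z k
      · rw [hd]
      · have h1 : cvec g ⬝ᵥ (Z *ᵥ cvec (v k)) = (Z *ᵥ cvec g) ⬝ᵥ cvec (v k) := by
          rw [dotProduct_mulVec, ← mulVec_transpose, hZ.eq]
        rw [hveig, ih i hik, dotProduct_smul, smul_dotProduct, smul_eq_mul, smul_eq_mul] at h1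
        have h2 : cvec g ⬝ᵥ cvec (v k) = 0 := by
          by_contra h3
          exact hd (mul_right_cancel₀ h3 h1).symm
        rw [dotProduct_cvec, Complex.ofReal_eq_zero] at h2
        rw [h2]
        simp
  set f := InnerProductSpace.gramSchmidtNormed ℝ v with hf
  have hfo : Orthonormal ℝ f := InnerProductSpace.gramSchmidtNormed_orthonormal hli
  have hfe : ∀ k, Z *ᵥ cvec (f k) = altDiag N z k • cvec (f k) := by
    intro k
    have e : cvec (f k) = ((‖InnerProductSpace.gramSchmidt ℝ v k‖⁻¹ : ℝ) : ℂ) •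
        cvec (InnerProductSpace.gramSchmidt ℝ v k) := by
      ext j; simp [cvec, hf, InnerProductSpace.gramSchmidtNormed]
    rw [e, mulVec_smul, hgs, smul_comm]
  set W : Matrix (Fin N) (Fin N) ℝ := Matrix.of fun k j => f k j with hW
  have hWo : W ∈ orthogonalGroup (Fin N) ℝ := by
    rw [mem_orthogonalGroup_iff]
    ext j k
    have h1 := orthonormal_iff_ite.1 hfo k j
    rw [mul_apply, one_apply]
    simpa [PiLp.inner_apply, hW, eq_comm (a := j)] using h1
  refine ⟨W, hWo, ?_, ?_⟩
  · intro k hk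
    have hv0 : v k = EuclideanSpace.single l 1 := by
      ext i
      simp only [hv, hk, pow_zero, one_mulVec, Pi.single_apply, PiLp.single_apply]
    have hgs0 : InnerProductSpace.gramSchmidt ℝ v k = v k := by
      rw [InnerProductSpace.gramSchmidt_def]
      have : Finset.Iio k = ∅ := by
        ext i
        simp only [Finset.mem_Iio, Finset.notMem_empty, iff_false, not_lt]
        exact Fin.le_def.2 (by omega)
      rw [this]
      simp
    ext i
    simp [hW, hf, InnerProductSpace.gramSchmidtNormed, hgs0, hv0, Pi.single_apply]
  · have hcol : Z * (W.map Complex.ofReal)ᵀ = (W.map Complex.ofReal)ᵀ * diagonal (altDiag N z) := by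
      ext i k
      have h1 := congrFun (hfe k) i
      rw [mul_diagonal]
      simp only [mulVec, dotProduct, cvec, Pi.smul_apply, smul_eq_mul] at h1
      simp only [mul_apply, transpose_apply, map_apply, hW, of_apply]
      rw [h1, mul_comm]
    rw [← hcol, mul_assoc, (map_ofReal_orthogonal hWo).1, mul_one]

/-! ### Steady states and alternating eigenbases -/

theorem HasAlternatingEigenbasis.mulVec_single {Z : Matrix (Fin N) (Fin N) ℂ} {z : ℂ} {l : Fin N}
    (h : HasAlternatingEigenbasis Z z l) : Z *ᵥ Pi.single l 1 = z • Pi.single l 1 := by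
  obtain ⟨W, hW, h0, rfl⟩ := h
  have hN : 0 < N := l.pos
  have e : (W.map Complex.ofReal)ᵀ *ᵥ Pi.single (⟨0, hN⟩ : Fin N) 1 = Pi.single l 1 := by
    ext j
    rw [mulVec_single_one, col_apply, transpose_apply, map_apply, h0 _ rfl]
    by_cases hj : j = l <;> simp [hj]
  rw [← e, mulVec_mulVec, mul_assoc, (map_ofReal_orthogonal hW).2, mul_one, ← mulVec_mulVec,
    diagonal_mulVec_single, ← mulVec_smul, ← Pi.single_smul]
  simp [altDiag]

/-- A system whose unique steady state is a given Gaussian state with an alternating eigenbasis: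
a chain of excitation exchanges between consecutive modes of the eigenbasis, the first of which is
damped. -/
def chainSystem (W : Matrix (Fin N) (Fin N) ℝ) (z : ℂ) (l : Fin N) : PassiveLocalSystem N where
  g j k := if j = k then (Wᵀ * pathMatrix N * W) j j / 2 else (Wᵀ * pathMatrix N * W) j k
  site := l
  c₁ := -z
  c₂ := 1

theorem chainSystem_couplingMatrix (W : Matrix (Fin N) (Fin N) ℝ) (z : ℂ) (l : Fin N) :
    (chainSystem W z l).couplingMatrix = Wᵀ * pathMatrix N * W := by
  have hs : (Wᵀ * pathMatrix N * W).IsSymm := by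
    rw [IsSymm, transpose_mul, transpose_mul, transpose_transpose, pathMatrix_isSymm.eq, mul_assoc]
  ext j k
  simp only [PassiveLocalSystem.couplingMatrix, chainSystem, of_apply]
  rcases lt_trichotomy j k with h | h | h
  · simp [h.ne, h]
  · subst h; simp; ring
  · simp [h.ne, h.ne', h.not_gt, hs.apply]

theorem exists_isUniqueSteadyState {Z : Matrix (Fin N) (Fin N) ℂ} (hZ : IsGraphMatrix Z)
    {ψ : 𝓢(Conf N, ℂ)} (hwave : IsGaussianWave ψ) (hnorm : ‖ket ψ‖ = 1)
    (hψ : ∀ j, momentum j ψ = posLin (Z j) ψ) {z : ℂ} (hz : z ≠ 0) {l : Fin N}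
    (h : HasAlternatingEigenbasis Z z l) :
    ∃ S : PassiveLocalSystem N,
      S.IsUniqueSteadyState (InnerProductSpace.rankOne ℂ (ket ψ) (ket ψ)) := by
  have hl := h.mulVec_single
  obtain ⟨W, hW, h0, hZW⟩ := h
  obtain ⟨hW1, hW2⟩ := map_ofReal_orthogonal hW
  set V := W.map Complex.ofReal with hV
  set J := (pathMatrix N).map Complex.ofReal with hJ
  have hR : (chainSystem W z l).couplingMatrixC = Vᵀ * J * V := by
    rw [PassiveLocalSystem.couplingMatrixC, chainSystem_couplingMatrix, map_ofReal_mul,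
      map_ofReal_mul, ← transpose_map]
  refine ⟨chainSystem W z l, PassiveLocalSystem.isUniqueSteadyState_of_cyclic _ hZ hwave hnorm hψ
    ?_ ?_ ?_⟩
  · change Pi.single l (-z) + Z *ᵥ Pi.single l 1 = 0
    rw [hl, ← Pi.single_smul, smul_eq_mul, mul_one, ← Pi.single_add, neg_add_cancel,
      Pi.single_zero]
  · have e : Vᵀ * diagonal (altDiag N z) * V * (Vᵀ * J * V) * (Vᵀ * diagonal (altDiag N z) * V) =
        Vᵀ * (diagonal (altDiag N z) * J * diagonal (altDiag N z)) * V := by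
      calc _ = Vᵀ * diagonal (altDiag N z) * (V * Vᵀ) * J * (V * Vᵀ) *
            diagonal (altDiag N z) * V := by simp only [mul_assoc]
        _ = _ := by rw [hW2]; simp only [mul_one, mul_assoc]
    rw [hR, hZW, e, ← add_mul, ← mul_add, pathMatrix_add_altDiag hz]
    simp
  · intro U hU0 hU
    refine eq_top_of_path_invariant hW1 hW2 (d := fun k => conj (altDiag N z k))
      (fun k => (map_ne_zero _).2 (altDiag_ne_zero hz k)) (U := U) ?_ ?_
    · intro k hk
      have e : Vᵀ *ᵥ Pi.single k 1 = Pi.single (chainSystem W z l).site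
          (conj (chainSystem W z l).c₂) := by
        ext j
        rw [mulVec_single_one, col_apply, transpose_apply, hV, map_apply, h0 _ hk]
        by_cases hj : j = l <;> simp [hj, chainSystem]
      rw [e]
      exact hU0
    · intro u hu
      have h1 := hU u hu
      have hVc : V.map conj = V := by ext; simp [hV]
      have hZc : Z.map conj = Vᵀ * diagonal (fun k => conj (altDiag N z k)) * V := by
        rw [hZW, Matrix.map_mul (f := starRingEnd ℂ), Matrix.map_mul (f := starRingEnd ℂ),
          diagonal_map (map_zero _), transpose_map, hVc]
      have e : Vᵀ * J * V * (Vᵀ * diagonal (fun k => conj (altDiag N z k)) * V) =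
          Vᵀ * J * diagonal (fun k => conj (altDiag N z k)) * V := by
        calc _ = Vᵀ * J * (V * Vᵀ) * diagonal (fun k => conj (altDiag N z k)) * V := by
              simp only [mul_assoc]
          _ = _ := by rw [hW2, mul_one]
      rw [hR, hZc, e] at h1
      exact h1

theorem IsGraphMatrix.im_diag_pos {n : Type*} [Fintype n] [DecidableEq n] {Z : Matrix n n ℂ}
    (hZ : IsGraphMatrix Z) (j : n) : 0 < (Z j j).im := hZ.2.diag_pos

/-- The necessary condition: if the Gaussian state is the unique steady state of a system with
coupling matrix `R`, then the coupled mode generates a cyclic subspace of `R` equal to the whole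
space, whence an alternating eigenbasis. -/
theorem hasAlternatingEigenbasis_of_unique {Z : Matrix (Fin N) (Fin N) ℂ} (hZ : IsGraphMatrix Z)
    {ψ : 𝓢(Conf N, ℂ)} (hwave : IsGaussianWave ψ) (hnorm : ‖ket ψ‖ = 1)
    (hmean : ∀ a, mean ψ a = 0) (hψ : ∀ j, momentum j ψ = posLin (Z j) ψ)
    {S : PassiveLocalSystem N}
    (hS : S.IsUniqueSteadyState (InnerProductSpace.rankOne ℂ (ket ψ) (ket ψ))) :
    ∃ z : ℂ, 0 < z.im ∧ HasAlternatingEigenbasis Z z S.site := by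
  have hψ0 : ∀ x, ψ x ≠ 0 := by
    obtain ⟨c, hc⟩ := wave_eq_of_nullifier hwave hψ
    intro x
    rw [hc]
    exact Complex.exp_ne_zero _
  have hq : ∀ j, inner ℂ (ket ψ) (ket (position j ψ)) = (0 : ℂ) := fun j => hmean (Sum.inl j)
  have hp : ∀ j, inner ℂ (ket ψ) (ket (momentum j ψ)) = (0 : ℂ) := fun j => hmean (Sum.inr j)
  have hLmean : inner ℂ (ket ψ) (ket (S.lindblad ψ)) = (0 : ℂ) := by
    rw [S.lindblad_apply, ket_add, ket_smul, ket_smul, inner_add_right, inner_smul_right,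
      inner_smul_right, hq, hp]
    simp
  obtain ⟨hL, E, hE⟩ := S.eigen_of_isSteadyState hnorm hLmean hS.1
  obtain ⟨hL', hRZ⟩ := S.algebraic_of_stationary hZ.1 hψ0 hψ hL hE
  have hK : ∀ K : Submodule ℂ (Fin N → ℂ), (∀ u ∈ K, (Z * S.couplingMatrixC) *ᵥ u ∈ K) →
      (∀ u ∈ K, S.c₂ * u S.site = 0) → K = ⊥ := by
    intro K h1 h2
    by_contra hne
    exact S.not_isUniqueSteadyState hZ.1 hψ0 hq hψ hL hE hne h1 h2 hS
  -- if `c₂ = 0` then every direction is decoupled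
  have hc₂ : S.c₂ ≠ 0 := by
    intro h0
    have h1 := hK ⊤ (fun _ _ => Submodule.mem_top) (fun u _ => by rw [h0, zero_mul])
    have h2 : (Pi.single S.site 1 : Fin N → ℂ) ∈ (⊥ : Submodule ℂ (Fin N → ℂ)) :=
      h1 ▸ Submodule.mem_top
    have h3 := congrFun ((Submodule.mem_bot ℂ).1 h2) S.site
    simp at h3
  set z : ℂ := -(S.c₁ / S.c₂) with hz
  have heig : Z *ᵥ Pi.single S.site 1 = z • Pi.single S.site 1 := by
    have e : (Pi.single S.site 1 : Fin N → ℂ) = S.c₂⁻¹ • Pi.single S.site S.c₂ := by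
      rw [← Pi.single_smul, smul_eq_mul, inv_mul_cancel₀ hc₂]
    have e2 : z • (Pi.single S.site 1 : Fin N → ℂ) = S.c₂⁻¹ • -Pi.single S.site S.c₁ := by
      rw [← Pi.single_smul, ← Pi.single_neg, ← Pi.single_smul, hz]
      congr 1
      simp only [smul_eq_mul, mul_one]
      ring
    rw [e2]
    nth_rewrite 1 [e]
    rw [mulVec_smul, eq_neg_of_add_eq_zero_right hL']
  have hzim : 0 < z.im := by
    have h1 := congrFun heig S.site
    rw [mulVec_single_one, col_apply] at h1
    have h2 := hZ.im_diag_pos S.site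
    rw [h1] at h2
    simpa using h2
  have hz0 : z ≠ 0 := by
    intro h0
    rw [h0] at hzim
    simp at hzim
  refine ⟨z, hzim, hasAlternatingEigenbasis_of_cyclic hZ.1 hRZ hz0 heig fun u hu => ?_⟩
  set R := S.couplingMatrixC with hR
  -- the orthogonal complement of the cyclic subspace is invariant under `Z R` and decoupled
  let K : Submodule ℂ (Fin N → ℂ) :=
    { carrier := {u | ∀ k : ℕ, u ⬝ᵥ (R ^ k *ᵥ Pi.single S.site 1) = 0}
      zero_mem' := fun k => zero_dotProduct _
      add_mem' := fun {a b} ha hb k => by rw [add_dotProduct, ha k, hb k, add_zero]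
      smul_mem' := fun c a ha k => by rw [smul_dotProduct, ha k, smul_zero] }
  have hKbot : K = ⊥ := by
    refine hK K (fun u hu k => ?_) (fun u hu => ?_)
    · have hs : Rᵀ = R := S.couplingMatrixC_isSymm.eq
      rw [dotProduct_comm, dotProduct_mulVec, ← vecMul_vecMul, ← mulVec_transpose,
        ← mulVec_transpose, hZ.1.eq, hs, mulVec_pow_eigen hRZ hz0 heig k, mulVec_smul,
        smul_dotProduct, mulVec_mulVec, ← pow_succ', dotProduct_comm, hu (k + 1), smul_zero]
    · have h1 := hu 0
      rw [pow_zero, one_mulVec, dotProduct_single, mul_one] at h1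
      rw [h1, mul_zero]
  have hmem : (fun i => (u i : ℂ)) ∈ K := by
    intro k
    have hpow : R ^ k = (S.couplingMatrix ^ k).map Complex.ofReal :=
      (map_pow Complex.ofRealHom.mapMatrix S.couplingMatrix k).symm
    have hsingle : (fun i => (((Pi.single S.site 1 : Fin N → ℝ) i : ℝ) : ℂ)) =
        Pi.single S.site 1 := by
      ext i
      by_cases hi : i = S.site <;> simp [hi]
    rw [hpow, ← hsingle, map_ofReal_mulVec]
    have h1 := congrArg Complex.ofReal (hu k)
    simpa [dotProduct] using h1
  rw [hKbot, Submodule.mem_bot] at hmem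
  ext i
  exact Complex.ofReal_eq_zero.1 (congrFun hmem i)

/-- A zero-mean pure Gaussian state is the unique steady state of a passive and locally coupled
system if and only if its graph matrix has an alternating eigenbasis. -/
theorem exists_unique_iff_hasAlternatingEigenbasis {Z : Matrix (Fin N) (Fin N) ℂ}
    {ρ : Hilb N →L[ℂ] Hilb N} (hρ : IsPureGaussianState Z ρ) :
    (∃ S : PassiveLocalSystem N, S.IsUniqueSteadyState ρ) ↔
      ∃ (z : ℂ) (l : Fin N), 0 < z.im ∧ HasAlternatingEigenbasis Z z l := by
  obtain ⟨hZ, ψ, hwave, hnorm, rfl, hmean, hcov⟩ := hρ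
  have hψ := nullifier_of_covariance hZ hnorm hmean hcov
  constructor
  · rintro ⟨S, hS⟩
    obtain ⟨z, hz, h⟩ := hasAlternatingEigenbasis_of_unique hZ hwave hnorm hmean hψ hS
    exact ⟨z, S.site, hz, h⟩
  · rintro ⟨z, l, hz, h⟩
    refine exists_isUniqueSteadyState hZ hwave hnorm hψ ?_ h
    rintro rfl
    simp at hz

/-! ### The block parametrization -/

section Blocks

variable {n m : ℕ}

/-- The real block matrix `diag[1, Q]`. -/
def diagOne (Q : Matrix (Fin n) (Fin n) ℝ) : Matrix (Fin (1 + n)) (Fin (1 + n)) ℝ :=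
  reindex finSumFinEquiv finSumFinEquiv (fromBlocks 1 0 0 Q)

/-- The real block matrix `diag[O_1, …, O_m]`, with the same indexing as `diagBlocks`. -/
def diagBlocksReal (O : Fin m → Matrix (Fin 2) (Fin 2) ℝ) :
    Matrix (Fin (m * 2)) (Fin (m * 2)) ℝ :=
  reindex ((Equiv.prodComm _ _).trans finProdFinEquiv)
    ((Equiv.prodComm _ _).trans finProdFinEquiv) (blockDiagonal O)

theorem diagOne_mul (P Q : Matrix (Fin n) (Fin n) ℝ) :
    diagOne P * diagOne Q = diagOne (P * Q) := by
  simp only [diagOne, reindex_apply, submatrix_mul_equiv, fromBlocks_multiply]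
  simp

theorem diagOne_transpose (Q : Matrix (Fin n) (Fin n) ℝ) : (diagOne Q)ᵀ = diagOne Qᵀ := by
  simp only [diagOne, reindex_apply, transpose_submatrix, fromBlocks_transpose]
  simp

theorem diagOne_one : diagOne (1 : Matrix (Fin n) (Fin n) ℝ) = 1 := by
  simp [diagOne]

theorem diagOne_injective : Function.Injective (diagOne (n := n)) := by
  intro P Q h
  exact (fromBlocks_inj.1 ((reindex _ _).injective h)).2.2.2

theorem diagOne_mem_orthogonalGroup {Q : Matrix (Fin n) (Fin n) ℝ} :
    diagOne Q ∈ orthogonalGroup (Fin (1 + n)) ℝ ↔ Q ∈ orthogonalGroup (Fin n) ℝ := by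
  rw [mem_orthogonalGroup_iff, mem_orthogonalGroup_iff, diagOne_transpose, diagOne_mul,
    ← diagOne_one, diagOne_injective.eq_iff]

theorem diagBlocksReal_mem_orthogonalGroup {O : Fin m → Matrix (Fin 2) (Fin 2) ℝ}
    (hO : ∀ j, O j ∈ orthogonalGroup (Fin 2) ℝ) :
    diagBlocksReal O ∈ orthogonalGroup (Fin (m * 2)) ℝ := by
  rw [mem_orthogonalGroup_iff]
  have h : (fun j => O j * (O j)ᵀ) = 1 := by
    funext j
    exact (mem_orthogonalGroup_iff _ _).1 (hO j)
  simp only [diagBlocksReal, reindex_apply, transpose_submatrix, submatrix_mul_equiv,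
    blockDiagonal_transpose, ← blockDiagonal_mul, h]
  rw [blockDiagonal_one, submatrix_one_equiv]

theorem diagCons_conj (z : ℂ) (A : Matrix (Fin n) (Fin n) ℂ) (Q : Matrix (Fin n) (Fin n) ℝ) :
    diagCons z ((Q.map Complex.ofReal)ᵀ * A * Q.map Complex.ofReal) =
      ((diagOne Q).map Complex.ofReal)ᵀ * diagCons z A * (diagOne Q).map Complex.ofReal := by
  simp only [diagOne, diagCons, reindex_apply, transpose_submatrix, ← submatrix_map,
    submatrix_mul_equiv, fromBlocks_map, fromBlocks_transpose, fromBlocks_multiply]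
  congr 1
  rw [map_ofReal_one]
  simp [Matrix.map_zero]

theorem diagBlocks_conj (D : Fin m → Matrix (Fin 2) (Fin 2) ℂ)
    (O : Fin m → Matrix (Fin 2) (Fin 2) ℝ) :
    diagBlocks (fun j => ((O j).map Complex.ofReal)ᵀ * D j * (O j).map Complex.ofReal) =
      ((diagBlocksReal O).map Complex.ofReal)ᵀ * diagBlocks D *
        (diagBlocksReal O).map Complex.ofReal := by
  simp only [diagBlocksReal, diagBlocks, reindex_apply, transpose_submatrix, ← submatrix_map,
    submatrix_mul_equiv, blockDiagonal_map _ _ Complex.ofReal_zero, blockDiagonal_transpose,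
    ← blockDiagonal_mul]

theorem diagCons_diagonal (z : ℂ) (d : Fin n → ℂ) :
    diagCons z (diagonal d) =
      diagonal (Sum.elim (fun _ => z) d ∘ (finSumFinEquiv (m := 1) (n := n)).symm) := by
  rw [diagCons, show (Matrix.of fun _ _ : Fin 1 => z) = diagonal fun _ => z by
    ext i j; simp [Subsingleton.elim i j], fromBlocks_diagonal, reindex_apply,
    submatrix_diagonal_equiv]

theorem diagBlocks_diagonal (x y : ℂ) :
    diagBlocks (m := m) (fun _ => diagonal ![x, y]) =
      diagonal fun k : Fin (m * 2) => if Even (k : ℕ) then x else y := by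
  rw [diagBlocks, blockDiagonal_diagonal, reindex_apply, submatrix_diagonal_equiv]
  congr 1
  funext k
  obtain ⟨⟨i, j⟩, rfl⟩ := finProdFinEquiv.surjective k
  have hk : ((Equiv.prodComm (Fin 2) (Fin m)).trans finProdFinEquiv).symm
      (finProdFinEquiv (i, j)) = (j, i) := by
    rw [Equiv.symm_apply_eq]
    rfl
  rw [Function.comp_apply, hk, finProdFinEquiv_apply_val]
  fin_cases j <;> simp [Nat.even_add]

theorem diagonal_altDiag_odd (z : ℂ) :
    diagCons z (diagBlocks (m := m) fun _ => diagonal ![-1 / z, z]) =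
      diagonal (altDiag (1 + m * 2) z) := by
  rw [diagBlocks_diagonal, diagCons_diagonal]
  congr 1
  funext k
  obtain ⟨k | k, rfl⟩ := finSumFinEquiv.surjective k
  · simp [altDiag, Subsingleton.elim k 0]
  · rw [Function.comp_apply, Equiv.symm_apply_apply, Sum.elim_inr]
    simp only [altDiag, finSumFinEquiv_apply_right, Fin.val_natAdd, add_comm 1, Nat.even_add_one]
    by_cases hk : Even (k : ℕ) <;> simp [hk]

theorem diagonal_altDiag_even (z : ℂ) :
    diagCons z (diagCons (-1 / z) (diagBlocks (m := m) fun _ => diagonal ![z, -1 / z])) =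
      diagonal (altDiag (1 + (1 + m * 2)) z) := by
  rw [diagBlocks_diagonal, diagCons_diagonal, diagCons_diagonal]
  congr 1
  funext k
  obtain ⟨k | k, rfl⟩ := finSumFinEquiv.surjective k
  · simp [altDiag, Subsingleton.elim k 0]
  · obtain ⟨k | k, rfl⟩ := finSumFinEquiv.surjective k
    · simp [altDiag, Subsingleton.elim k 0]
    · rw [Function.comp_apply, Equiv.symm_apply_apply, Sum.elim_inr, Function.comp_apply,
        Equiv.symm_apply_apply, Sum.elim_inr]
      simp only [altDiag, finSumFinEquiv_apply_right, Fin.val_natAdd, add_comm 1,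
        Nat.even_add_one, not_not]

/-- Conjugating the lower block by an orthogonal matrix does not change the form. -/
theorem HasForm.of_conj {Z : Matrix (Fin (1 + n)) (Fin (1 + n)) ℂ} {z : ℂ}
    {A : Matrix (Fin n) (Fin n) ℂ} {O : Matrix (Fin n) (Fin n) ℝ}
    (hO : O ∈ orthogonalGroup (Fin n) ℝ)
    (h : HasForm Z z ((O.map Complex.ofReal)ᵀ * A * O.map Complex.ofReal)) : HasForm Z z A := by
  obtain ⟨σ, Q, hQ, rfl⟩ := h
  refine ⟨σ, O * Q, mul_mem hO hQ, ?_⟩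
  change _ = (σ.permMatrix ℂ)ᵀ * diagCons z (((O * Q).map Complex.ofReal)ᵀ * A *
    (O * Q).map Complex.ofReal) * σ.permMatrix ℂ
  congr 3
  rw [map_ofReal_mul, transpose_mul]
  simp only [mul_assoc]

theorem HasForm.conj {Z : Matrix (Fin (1 + n)) (Fin (1 + n)) ℂ} {z : ℂ}
    {A : Matrix (Fin n) (Fin n) ℂ} {O : Matrix (Fin n) (Fin n) ℝ}
    (hO : O ∈ orthogonalGroup (Fin n) ℝ) (h : HasForm Z z A) :
    HasForm Z z ((O.map Complex.ofReal)ᵀ * A * O.map Complex.ofReal) := by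
  have hO' : Oᵀ ∈ orthogonalGroup (Fin n) ℝ := by
    rw [mem_orthogonalGroup_iff, transpose_transpose]
    exact (mem_orthogonalGroup_iff' _ _).1 hO
  refine HasForm.of_conj hO' ?_
  have e : (Oᵀ.map Complex.ofReal)ᵀ * ((O.map Complex.ofReal)ᵀ * A * O.map Complex.ofReal) *
      Oᵀ.map Complex.ofReal = A := by
    have h2 := (map_ofReal_orthogonal hO).2
    rw [transpose_map, transpose_transpose]
    calc _ = (O.map Complex.ofReal * (O.map Complex.ofReal)ᵀ) * A *
          (O.map Complex.ofReal * (O.map Complex.ofReal)ᵀ) := by simp only [mul_assoc]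
      _ = A := by rw [h2, one_mul, mul_one]
  rwa [e]

theorem diagOne_row_zero (Q : Matrix (Fin n) (Fin n) ℝ) {k : Fin (1 + n)} (hk : (k : ℕ) = 0) :
    diagOne Q k = Pi.single k 1 := by
  have hk' : k = finSumFinEquiv (Sum.inl 0) := Fin.ext (by simp [hk])
  subst hk'
  ext j
  obtain ⟨j | j, rfl⟩ := finSumFinEquiv.surjective j
  · simp [diagOne, Subsingleton.elim j 0]
  · rw [Pi.single_eq_of_ne (finSumFinEquiv.injective.ne (by simp))]
    simp [diagOne]

theorem permMatrix_map_ofReal {k : Type*} [DecidableEq k] (σ : Equiv.Perm k) :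
    (σ.permMatrix ℝ).map Complex.ofReal = σ.permMatrix ℂ := by
  ext i j
  simp [PEquiv.toMatrix_apply, apply_ite]

theorem permMatrix_mem_orthogonalGroup {k : Type*} [Fintype k] [DecidableEq k]
    (σ : Equiv.Perm k) : σ.permMatrix ℝ ∈ orthogonalGroup k ℝ := by
  rw [mem_orthogonalGroup_iff, transpose_permMatrix, ← permMatrix_mul, inv_mul_cancel,
    permMatrix_one]

/-- The permutation and the orthogonal matrix of the parametrization are equivalent to a single
orthogonal matrix whose first row is a coordinate vector. -/
theorem hasForm_iff {Z : Matrix (Fin (1 + n)) (Fin (1 + n)) ℂ} {z : ℂ}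
    {A : Matrix (Fin n) (Fin n) ℂ} :
    HasForm Z z A ↔ ∃ l, ∃ W ∈ orthogonalGroup (Fin (1 + n)) ℝ,
      (∀ k : Fin (1 + n), (k : ℕ) = 0 → W k = Pi.single l 1) ∧
      Z = (W.map Complex.ofReal)ᵀ * diagCons z A * W.map Complex.ofReal := by
  constructor
  · rintro ⟨σ, Q, hQ, rfl⟩
    refine ⟨σ (finSumFinEquiv (Sum.inl 0)), diagOne Q * σ.permMatrix ℝ,
      mul_mem (diagOne_mem_orthogonalGroup.2 hQ) (permMatrix_mem_orthogonalGroup σ), ?_, ?_⟩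
    · intro k hk
      have hk' : finSumFinEquiv (Sum.inl 0) = k := Fin.ext (by simp [hk])
      ext j
      rw [hk', Equiv.Perm.permMatrix, PEquiv.mul_toMatrix_toPEquiv, submatrix_apply, id,
        diagOne_row_zero Q hk, Pi.single_apply, Pi.single_apply]
      simp only [Equiv.symm_apply_eq]
    · rw [map_ofReal_mul, permMatrix_map_ofReal, transpose_mul]
      have h := diagCons_conj z A Q
      change (σ.permMatrix ℂ)ᵀ * diagCons z ((Q.map Complex.ofReal)ᵀ * A *
        Q.map Complex.ofReal) * σ.permMatrix ℂ = _
      rw [h]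
      simp only [mul_assoc]
  · rintro ⟨l, W, hW, h0, rfl⟩
    set k₀ : Fin (1 + n) := finSumFinEquiv (Sum.inl 0) with hk₀
    have hk₀' : (k₀ : ℕ) = 0 := by simp [hk₀]
    set σ : Equiv.Perm (Fin (1 + n)) := Equiv.swap k₀ l with hσ
    have hσo := permMatrix_mem_orthogonalGroup σ
    set P := σ.permMatrix ℝ with hP
    have hPt : Pᵀ ∈ orthogonalGroup (Fin (1 + n)) ℝ := by
      rw [mem_orthogonalGroup_iff, transpose_transpose]
      exact (mem_orthogonalGroup_iff' _ _).1 hσo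
    set B := W * Pᵀ with hB
    have hBo : B ∈ orthogonalGroup (Fin (1 + n)) ℝ := mul_mem hW hPt
    have hBP : B * P = W := by
      rw [hB, mul_assoc, (mem_orthogonalGroup_iff' _ _).1 hσo, mul_one]
    have hrow : ∀ j, B k₀ j = if j = k₀ then 1 else 0 := by
      intro j
      rw [hB, hP, transpose_permMatrix, Equiv.Perm.permMatrix, PEquiv.mul_toMatrix_toPEquiv,
        submatrix_apply, id, h0 k₀ hk₀', Pi.single_apply]
      have : (Equiv.symm σ⁻¹) j = l ↔ j = k₀ := by
        change σ j = l ↔ j = k₀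
        rw [hσ, Equiv.swap_apply_eq_iff, Equiv.swap_apply_right]
      simp only [this]
    -- the rows of `B` are orthonormal and the first one is a coordinate vector, so that the
    -- first column is the same coordinate vector
    have hcol : ∀ i, B i k₀ = if i = k₀ then 1 else 0 := by
      intro i
      have h1 := congrFun (congrFun ((mem_orthogonalGroup_iff _ _).1 hBo) i) k₀
      simpa [mul_apply, hrow, one_apply] using h1
    set Q : Matrix (Fin n) (Fin n) ℝ :=
      Matrix.of fun i j => B (finSumFinEquiv (Sum.inr i)) (finSumFinEquiv (Sum.inr j)) with hQ
    have hBQ : B = diagOne Q := by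
      ext i j
      obtain ⟨i | i, rfl⟩ := finSumFinEquiv.surjective i
      · have hi : finSumFinEquiv (Sum.inl i) = k₀ := by rw [hk₀, Subsingleton.elim i 0]
        rw [hi, hrow, diagOne_row_zero Q hk₀', Pi.single_apply]
      · obtain ⟨j | j, rfl⟩ := finSumFinEquiv.surjective j
        · have hj : (finSumFinEquiv (Sum.inl j) : Fin (1 + n)) = k₀ := by
            rw [hk₀, Subsingleton.elim j 0]
          have hi : (finSumFinEquiv (Sum.inr i) : Fin (1 + n)) ≠ k₀ :=
            finSumFinEquiv.injective.ne (by simp)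
          rw [hj, hcol, if_neg hi, ← hj]
          simp only [diagOne, reindex_apply, submatrix_apply, Equiv.symm_apply_apply,
            fromBlocks_apply₂₁, Matrix.zero_apply]
        · simp only [diagOne, reindex_apply, submatrix_apply, Equiv.symm_apply_apply,
            fromBlocks_apply₂₂, hQ, of_apply]
    refine ⟨σ, Q, diagOne_mem_orthogonalGroup.1 (hBQ ▸ hBo), ?_⟩
    change _ = (σ.permMatrix ℂ)ᵀ * diagCons z ((Q.map Complex.ofReal)ᵀ * A *
      Q.map Complex.ofReal) * σ.permMatrix ℂ
    rw [diagCons_conj, ← hBQ, ← hBP, map_ofReal_mul, hP, permMatrix_map_ofReal, transpose_mul]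
    simp only [mul_assoc]

/-! ### The set `Δ` -/

/-- The elements of `Δ` are the symmetric matrices with equal diagonal entries and eigenvalues
`z` and `-1/z`. -/
theorem exists_of_mem_delta {z : ℂ} {B : Matrix (Fin 2) (Fin 2) ℂ} (hz : z ≠ 0)
    (hB : B ∈ Delta z) : ∃ a b : ℂ, B = !![a, b; b, a] ∧
      ((a + b = z ∧ a - b = -1 / z) ∨ (a + b = -1 / z ∧ a - b = z)) := by
  obtain ⟨⟨hs, hpos⟩, hsq, hdet⟩ := hB
  have hsym : B 1 0 = B 0 1 := hs.apply 0 1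
  have hB2 : B = !![B 0 0, B 0 1; B 0 1, B 1 1] := by
    ext i j
    fin_cases i <;> fin_cases j <;> simp [hsym]
  have ha : 0 < (B 0 0).im := hpos.diag_pos
  have hd : 0 < (B 1 1).im := hpos.diag_pos
  set a := B 0 0
  set b := B 0 1
  set d := B 1 1
  rw [hB2, pow_two] at hsq
  have e00 := congrFun (congrFun hsq 0) 0
  have e01 := congrFun (congrFun hsq 0) 1
  have e11 := congrFun (congrFun hsq 1) 1
  simp [mul_apply, Fin.sum_univ_two, diagonal_apply] at e00 e01 e11
  rw [hB2, det_fin_two] at hdet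
  simp at hdet
  -- the equation `(diag[1, -1] B)² = -1` gives `b (a - d) = 0`; if `b = 0` then `a² = d² = -1`, and
  -- positivity leaves `a = d = i`
  have hI : ∀ w : ℂ, 0 < w.im → w * w = -1 → w = Complex.I := by
    intro w hw h
    have h1 : (w - Complex.I) * (w + Complex.I) = 0 := by
      linear_combination h - Complex.I_sq
    rcases mul_eq_zero.1 h1 with h2 | h2
    · exact sub_eq_zero.1 h2
    · rw [eq_neg_of_add_eq_zero_left h2] at hw
      simp at hw
      linarith
  have had : a = d := by
    have h1 : b * (a - d) = 0 := by linear_combination e01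
    rcases mul_eq_zero.1 h1 with h2 | h2
    · rw [h2] at e00 e11
      rw [hI a ha (by linear_combination e00), hI d hd (by linear_combination e11)]
    · exact sub_eq_zero.1 h2
  rw [← had] at hdet hB2
  have hprod : (a + b) * (a - b) = -1 := by linear_combination e00
  refine ⟨a, b, hB2, ?_⟩
  have h1 : (a - b + z⁻¹) * (a + b + z⁻¹) = 0 := by linear_combination hdet
  have hinv : ∀ x y : ℂ, x * y = -1 → y = -1 / z → x = z := by
    intro x y hxy hy
    rw [hy] at hxy
    field_simp at hxy
    linear_combination -hxy
  have hneg : -1 / z = -z⁻¹ := by rw [neg_div, one_div]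
  rcases mul_eq_zero.1 h1 with h2 | h2
  · have h3 : a - b = -1 / z := by rw [hneg]; linear_combination h2
    exact Or.inl ⟨hinv _ _ hprod h3, h3⟩
  · have h3 : a + b = -1 / z := by rw [hneg]; linear_combination h2
    exact Or.inr ⟨h3, hinv _ _ (by rw [mul_comm]; exact hprod) h3⟩

theorem delta_nonempty {z : ℂ} (hz : 0 < z.im) : (Delta z).Nonempty := by
  have hz0 : z ≠ 0 := by
    rintro rfl
    simp at hz
  obtain ⟨a, b, hab, hab'⟩ : ∃ a b : ℂ, a + b = z ∧ a - b = -1 / z :=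
    ⟨(z + -1 / z) / 2, (z - -1 / z) / 2, by ring, by ring⟩
  have hprod : (a + b) * (a - b) = -1 := by
    rw [hab, hab']; field_simp
  have h1 : 0 < a.im + b.im := by
    rw [← Complex.add_im, hab]; exact hz
  have h2 : 0 < a.im - b.im := by
    rw [← Complex.sub_im, hab', neg_div, one_div, Complex.neg_im, Complex.inv_im, neg_div, neg_neg]
    exact div_pos hz (Complex.normSq_pos.2 hz0)
  refine ⟨!![a, b; b, a], ⟨?_, ?_⟩, ?_, ?_⟩
  · ext i j
    fin_cases i <;> fin_cases j <;> simp
  · refine PosDef.of_dotProduct_mulVec_pos ?_ fun x hx => ?_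
    · ext i j
      fin_cases i <;> fin_cases j <;> simp
    · simp only [dotProduct, mulVec, Fin.sum_univ_two, star_trivial, map_apply, of_apply, cons_val',
        cons_val_zero, cons_val_one, cons_val_fin_one]
      have hne : x 0 + x 1 ≠ 0 ∨ x 0 - x 1 ≠ 0 := by
        by_contra hcon
        push Not at hcon
        apply hx
        ext i
        fin_cases i
        · simp; linarith
        · simp; linarith
      have e : x 0 * (a.im * x 0 + b.im * x 1) + x 1 * (b.im * x 0 + a.im * x 1) =
          ((a.im + b.im) * (x 0 + x 1) ^ 2 + (a.im - b.im) * (x 0 - x 1) ^ 2) / 2 := by ring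
      rw [e]
      rcases hne with h | h
      · have : 0 < (x 0 + x 1) ^ 2 := by positivity
        have := mul_pos h1 this
        have := mul_nonneg h2.le (sq_nonneg (x 0 - x 1))
        linarith
      · have : 0 < (x 0 - x 1) ^ 2 := by positivity
        have := mul_pos h2 this
        have := mul_nonneg h1.le (sq_nonneg (x 0 + x 1))
        linarith
  · rw [pow_two]
    ext i j
    fin_cases i <;> fin_cases j <;> simp [mul_apply, Fin.sum_univ_two, diagonal_apply] <;>
      first | linear_combination hprod | ring
  · rw [det_fin_two]
    simp
    have : a - b = -z⁻¹ := by rw [hab', neg_div, one_div]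
    linear_combination (a + b + z⁻¹) * this

/-- Symmetric matrices with equal diagonal entries are diagonalized by an orthogonal matrix with
entries `±1/√2`; the order of its rows is the order of the eigenvalues. -/
theorem exists_orthogonal_conj (a b x y : ℂ)
    (h : (a + b = x ∧ a - b = y) ∨ (a + b = y ∧ a - b = x)) :
    ∃ O ∈ orthogonalGroup (Fin 2) ℝ,
      !![a, b; b, a] = (O.map Complex.ofReal)ᵀ * diagonal ![x, y] * O.map Complex.ofReal := by
  set s : ℝ := (√2)⁻¹ with hs
  have hs2 : s * s = 1 / 2 := by
    rw [hs, ← mul_inv, Real.mul_self_sqrt (by norm_num), one_div]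
  have hs2c : (s : ℂ) * s = 1 / 2 := by
    rw [← Complex.ofReal_mul, hs2]; norm_num
  rcases h with ⟨rfl, rfl⟩ | ⟨rfl, rfl⟩
  · refine ⟨!![s, s; s, -s], ?_, ?_⟩
    · rw [mem_orthogonalGroup_iff]
      ext i j
      fin_cases i <;> fin_cases j <;> simp [mul_apply, Fin.sum_univ_two] <;> linarith
    · ext i j
      fin_cases i <;> fin_cases j <;>
        simp [mul_apply, Fin.sum_univ_two, diagonal_apply]
      · linear_combination (-2 * a) * hs2c
      · linear_combination (-2 * b) * hs2c
      · linear_combination (-2 * b) * hs2c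
      · linear_combination (-2 * a) * hs2c
  · refine ⟨!![s, -s; s, s], ?_, ?_⟩
    · rw [mem_orthogonalGroup_iff]
      ext i j
      fin_cases i <;> fin_cases j <;> simp [mul_apply, Fin.sum_univ_two] <;> linarith
    · ext i j
      fin_cases i <;> fin_cases j <;>
        simp [mul_apply, Fin.sum_univ_two, diagonal_apply]
      · linear_combination (-2 * a) * hs2c
      · linear_combination (-2 * b) * hs2c
      · linear_combination (-2 * b) * hs2c
      · linear_combination (-2 * a) * hs2c

/-- For fixed `z`, a block-diagonal matrix with blocks in `Δ` is orthogonally conjugate to the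
diagonal matrix with the eigenvalues `z` and `-1/z` in each block, in either order. -/
theorem diagBlocks_delta {z x y : ℂ} (hz : z ≠ 0)
    (hxy : (x = z ∧ y = -1 / z) ∨ (x = -1 / z ∧ y = z))
    {B : Fin m → Matrix (Fin 2) (Fin 2) ℂ} (hB : ∀ j, B j ∈ Delta z) :
    ∃ O ∈ orthogonalGroup (Fin (m * 2)) ℝ, diagBlocks B =
      (O.map Complex.ofReal)ᵀ * diagBlocks (fun _ => diagonal ![x, y]) * O.map Complex.ofReal := by
  have h : ∀ j, ∃ O ∈ orthogonalGroup (Fin 2) ℝ,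
      B j = (O.map Complex.ofReal)ᵀ * diagonal ![x, y] * O.map Complex.ofReal := by
    intro j
    obtain ⟨a, b, hab, h⟩ := exists_of_mem_delta hz (hB j)
    rw [hab]
    refine exists_orthogonal_conj a b x y ?_
    rcases hxy with ⟨rfl, rfl⟩ | ⟨rfl, rfl⟩
    · exact h
    · exact h.symm
  choose O hO hBO using h
  refine ⟨diagBlocksReal O, diagBlocksReal_mem_orthogonalGroup hO, ?_⟩
  rw [← diagBlocks_conj, funext hBO]

theorem hasAlternatingEigenbasis_iff_odd {Z : Matrix (Fin (1 + m * 2)) (Fin (1 + m * 2)) ℂ}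
    {z : ℂ} (hz : 0 < z.im) :
    (∃ l, HasAlternatingEigenbasis Z z l) ↔
      ∃ B : Fin m → Matrix (Fin 2) (Fin 2) ℂ, (∀ j, B j ∈ Delta z) ∧
        HasForm Z z (diagBlocks B) := by
  have hz0 : z ≠ 0 := by
    rintro rfl
    simp at hz
  have h : (∃ l, HasAlternatingEigenbasis Z z l) ↔
      HasForm Z z (diagBlocks fun _ => diagonal ![-1 / z, z]) := by
    rw [hasForm_iff]
    simp only [HasAlternatingEigenbasis, diagonal_altDiag_odd]
  rw [h]
  constructor
  · intro hf
    obtain ⟨B, hB⟩ := delta_nonempty hz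
    obtain ⟨O, hO, he⟩ := diagBlocks_delta (m := m) hz0 (Or.inr ⟨rfl, rfl⟩) (fun _ => hB)
    exact ⟨fun _ => B, fun _ => hB, he ▸ hf.conj hO⟩
  · rintro ⟨B, hB, hf⟩
    obtain ⟨O, hO, he⟩ := diagBlocks_delta hz0 (Or.inr ⟨rfl, rfl⟩) hB
    exact HasForm.of_conj hO (he ▸ hf)

theorem hasAlternatingEigenbasis_iff_even
    {Z : Matrix (Fin (1 + (1 + m * 2))) (Fin (1 + (1 + m * 2))) ℂ} {z : ℂ} (hz : 0 < z.im) :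
    (∃ l, HasAlternatingEigenbasis Z z l) ↔
      ∃ B : Fin m → Matrix (Fin 2) (Fin 2) ℂ, (∀ j, B j ∈ Delta z) ∧
        HasForm Z z (diagCons (-1 / z) (diagBlocks B)) := by
  have hz0 : z ≠ 0 := by
    rintro rfl
    simp at hz
  have h : (∃ l, HasAlternatingEigenbasis Z z l) ↔
      HasForm Z z (diagCons (-1 / z) (diagBlocks fun _ => diagonal ![z, -1 / z])) := by
    rw [hasForm_iff]
    simp only [HasAlternatingEigenbasis, diagonal_altDiag_even]
  rw [h]
  constructor
  · intro hf
    obtain ⟨B, hB⟩ := delta_nonempty hz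
    obtain ⟨O, hO, he⟩ := diagBlocks_delta (m := m) hz0 (Or.inl ⟨rfl, rfl⟩) (fun _ => hB)
    refine ⟨fun _ => B, fun _ => hB, ?_⟩
    rw [he, diagCons_conj]
    exact hf.conj (diagOne_mem_orthogonalGroup.2 hO)
  · rintro ⟨B, hB, hf⟩
    obtain ⟨O, hO, he⟩ := diagBlocks_delta hz0 (Or.inl ⟨rfl, rfl⟩) hB
    rw [he, diagCons_conj] at hf
    exact HasForm.of_conj (diagOne_mem_orthogonalGroup.2 hO) hf

end Blocks

end LinearQuantum

end

theorem theorem1 :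
    -- an odd number of modes `N = 1 + 2m`
    (∀ (m : ℕ) (Z : Matrix (Fin (1 + m * 2)) (Fin (1 + m * 2)) ℂ)
      (ρ : LinearQuantum.Hilb (1 + m * 2) →L[ℂ] LinearQuantum.Hilb (1 + m * 2)),
      LinearQuantum.IsPureGaussianState Z ρ →
      ((∃ S : LinearQuantum.PassiveLocalSystem (1 + m * 2), S.IsUniqueSteadyState ρ) ↔
        ∃ (z : ℂ) (B : Fin m → Matrix (Fin 2) (Fin 2) ℂ),
          0 < z.im ∧ (∀ j, B j ∈ LinearQuantum.Delta z) ∧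
          LinearQuantum.HasForm Z z (LinearQuantum.diagBlocks B))) ∧
    -- an even number of modes `N = 2 + 2m`
    (∀ (m : ℕ) (Z : Matrix (Fin (1 + (1 + m * 2))) (Fin (1 + (1 + m * 2))) ℂ)
      (ρ : LinearQuantum.Hilb (1 + (1 + m * 2)) →L[ℂ] LinearQuantum.Hilb (1 + (1 + m * 2))),
      LinearQuantum.IsPureGaussianState Z ρ →
      ((∃ S : LinearQuantum.PassiveLocalSystem (1 + (1 + m * 2)), S.IsUniqueSteadyState ρ) ↔
        ∃ (z : ℂ) (B : Fin m → Matrix (Fin 2) (Fin 2) ℂ),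
          0 < z.im ∧ (∀ j, B j ∈ LinearQuantum.Delta z) ∧
          LinearQuantum.HasForm Z z
            (LinearQuantum.diagCons (-1 / z) (LinearQuantum.diagBlocks B)))) := by
  constructor
  · intro m Z ρ hρ
    rw [LinearQuantum.exists_unique_iff_hasAlternatingEigenbasis hρ]
    constructor
    · rintro ⟨z, l, hz, h⟩
      obtain ⟨B, hB⟩ := (LinearQuantum.hasAlternatingEigenbasis_iff_odd hz).1 ⟨l, h⟩
      exact ⟨z, B, hz, hB⟩
    · rintro ⟨z, B, hz, hB⟩
      obtain ⟨l, h⟩ := (LinearQuantum.hasAlternatingEigenbasis_iff_odd hz).2 ⟨B, hB⟩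
      exact ⟨z, l, hz, h⟩
  · intro m Z ρ hρ
    rw [LinearQuantum.exists_unique_iff_hasAlternatingEigenbasis hρ]
    constructor
    · rintro ⟨z, l, hz, h⟩
      obtain ⟨B, hB⟩ := (LinearQuantum.hasAlternatingEigenbasis_iff_even hz).1 ⟨l, h⟩
      exact ⟨z, B, hz, hB⟩
    · rintro ⟨z, B, hz, hB⟩
      obtain ⟨l, h⟩ := (LinearQuantum.hasAlternatingEigenbasis_iff_even hz).2 ⟨B, hB⟩
      exact ⟨z, l, hz, h⟩
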